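/- **Quantum HC-generation Theorem.** For $N\ge 2$ put $m=\lceil\log_2 N\rceil$ and consider $N$ index registers of $m$ qubits each, together with $m$ ancilla qubits. A (directed) Hamiltonian cycle on a set $\{k,\dots,N-1\}$ is given by its successor permutation $\sigma$ and is encoded as the basis state $|\sigma\rangle$ in which register $i\ge k$ holds $\sigma(i)$ in binary, and all registers $i<k$ and all ancillas are $0$. Circuits consist of Hadamard gates, gates $R_Z(\theta)$ with arbitrary real $\theta$, and multi-controlled NOT gates (any number of controls, each of either polarity; $X$ is the case of no controls), and each such gate counts as one. There is a constant $C$ such that for every $N\ge 2$ there are exactly $(N-1)!$ Hamiltonian cycles on $\{0,\dots,N-1\}$, and there is a circuit of at most $C\,N^{5/2}$ gates on these qubits that maps $|0\cdots0\rangle$ exactly to $$\frac1{\sqrt{(N-1)!}}\sum_{\sigma}|\sigma\rangle ,$$ the sum being over these $(N-1)!$ cycles (with all ancillas returned to $0$). It carries out the insertion recursion coherently: it first prepares the cycle on $\{N-2,N-1\}$ and then inserts the vertices $w=N-3,N-4,\dots,0$ one after another, so that after the insertion of $k$ (for $k=N-2$: after the preparation) the state is exactly $\frac1{\sqrt{(N-k-1)!}}\sum_\sigma|\sigma\rangle$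 over all Hamiltonian cycles $\sigma$ on $\{k,\dots,N-1\}$. The insertion of $w$ maps each $|\sigma\rangle$, $\sigma$ a Hamiltonian cycle on $\{w+1,\dots,N-1\}$, to $\frac1{\sqrt{N-w-1}}\sum_{j=w+1}^{N-1}|\sigma_j\rangle$, where $\sigma_j$ arises from $\sigma$ by replacing the edge $u\to j$ with $u\to w\to j$. It consists of two parts: 1. exact amplitude amplification, using only register $w$ and the ancillas: $H^{\otimes m}$ on register $w$, followed by some number of Grover iterations $H^{\otimes m}S_0(\varphi)H^{\otimes m}S_\chi(\varphi)$ and a correction of the global phase, where $S_0(\varphi)$ and $S_\chi(\varphi)$ multiply by $e^{i\varphi}$ the basis states in which register $w$ holds $0$, respectively a number $j$ with $w<j<N$. It maps $|0\rangle$ in register $w$ exactly to $\frac1{\sqrt{N-w-1}}\sum_{j=w+1}^{N-1}|j\rangle$, with zero failure probability; 2. for each $i=w+1,\dots,N-1$ a compare-and-replace module, a reversible classical circuit made of multi-controlled NOT gates on the registers $w$, $i$ and the ancillas: when both registers hold numbers in $\{w+1,\dots,N-1\}$ and the ancillas are $0$, it replaces the content of register $i$ by $w$ if the two contents are equal, and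 otherwise changes nothing; register $w$ and the ancillas are returned unchanged. -/

import Mathlib

/-- Elementary gates on a set `Q` of qubits. `mcx t S v` is the multi-controlled NOT gate with
target `t`, control set `S` and control polarities `v`: it flips `t` exactly when every control
`q ∈ S` has the value `v q` (`true`: ordinary control, `false`: anti-control).
With `S = ∅` it is the `X` gate. -/
inductive Gate (Q : Type) : Type where
  | h (q : Q) : Gate Q
  | rz (θ : ℝ) (q : Q) : Gate Q
  | mcx (t : Q) (S : Finset Q) (v : Q → Bool) (ht : t ∉ S) : Gate Q

namespace Gate

/-- The set of qubits touched by a gate. -/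
def qubits {Q : Type} : Gate Q → Set Q
  | h q => {q}
  | rz _ q => {q}
  | mcx t S _ _ => insert t {q | q ∈ S}

/-- The gate is a multi-controlled NOT gate (so it permutes the computational basis). -/
def IsMCX {Q : Type} : Gate Q → Prop
  | h _ => False
  | rz _ _ => False
  | mcx _ _ _ _ => True

/-- The action of a gate on a state vector, given by its amplitudes in the computational basis:
`H` is the Hadamard gate, `RZ(θ) = diag (exp (-iθ/2), exp (iθ/2))`, and the multi-controlled NOT
gate is the basis permutation described above (an involution). -/
noncomputable def apply {Q : Type} [DecidableEq Q] :
    Gate Q → ((Q → Bool) → ℂ) → ((Q → Bool) → ℂ)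
  | h q, ψ => fun x =>
      (ψ (Function.update x q false) + (if x q then -1 else 1) * ψ (Function.update x q true))
        / (Real.sqrt 2 : ℂ)
  | rz θ q, ψ => fun x =>
      (if x q then Complex.exp ((θ / 2 : ℝ) * Complex.I)
        else Complex.exp (-((θ / 2 : ℝ) * Complex.I))) * ψ x
  | mcx t S v _, ψ => fun x =>
      ψ (if ∀ q ∈ S, x q = v q then Function.update x t (!(x t)) else x)

end Gate

/-- A circuit is a finite sequence of gates; the head of the list is executed first.
The number of gates is the length of the list. -/
abbrev Circuit (Q : Type) : Type := List (Gate Q)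

namespace Circuit

/-- The state obtained by running a circuit on a state. -/
noncomputable def run {Q : Type} [DecidableEq Q] (c : Circuit Q) (ψ : (Q → Bool) → ℂ) :
    (Q → Bool) → ℂ :=
  c.foldl (fun φ g => g.apply φ) ψ

/-- All gates of the circuit touch only qubits of `S`. -/
def ActsOn {Q : Type} (c : Circuit Q) (S : Set Q) : Prop := ∀ g ∈ c, g.qubits ⊆ S

end Circuit

namespace HamCycle

/-- The number `⌈log₂ N⌉` of qubits in one register. -/
def width (N : ℕ) : ℕ := Nat.clog 2 N

/-- The qubits: `N` index registers of `⌈log₂ N⌉` qubits each, and `⌈log₂ N⌉` ancilla qubits. -/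
abbrev Qubit (N : ℕ) : Type := (Fin N × Fin (width N)) ⊕ Fin (width N)

/-- The `N` index registers hold the binary expansions of the numbers `s i`; all ancillas are 0. -/
def encode {N : ℕ} (s : Fin N → ℕ) : Qubit N → Bool
  | Sum.inl (i, b) => (s i).testBit b
  | Sum.inr _ => false

/-- The labels whose entries fit into the registers. -/
def Fits {N : ℕ} (s : Fin N → ℕ) : Prop := ∀ i, s i < 2 ^ width N

/-- The computational basis state `|s 0⟩ |s 1⟩ ⋯ |s (N-1)⟩ |0⋯0⟩`. -/
noncomputable def ket {N : ℕ} (s : Fin N → ℕ) : (Qubit N → Bool) → ℂ :=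
  Pi.single (encode s) 1

/-- The qubits of the index register `i`. -/
def register {N : ℕ} (i : Fin N) : Set (Qubit N) := {q | ∃ b, q = Sum.inl (i, b)}

/-- The ancilla qubits. -/
def ancillas (N : ℕ) : Set (Qubit N) := Set.range Sum.inr

open Classical in
/-- The (directed) Hamiltonian cycles on the vertices `k, k + 1, …, N - 1`, each given by its
successor permutation: a single cycle that moves exactly these vertices. -/
noncomputable def cyclesFrom (N k : ℕ) : Finset (Equiv.Perm (Fin N)) :=
  Finset.univ.filter fun σ => σ.IsCycle ∧ ∀ i : Fin N, σ i ≠ i ↔ k ≤ (i : ℕ)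

/-- The successor encoding of a cycle on `k, …, N - 1`: register `i ≥ k` holds the successor of
`i`, and the registers below `k` are still empty, that is 0. -/
def successors {N : ℕ} (k : ℕ) (σ : Equiv.Perm (Fin N)) (i : Fin N) : ℕ :=
  if k ≤ (i : ℕ) then (σ i : ℕ) else 0

/-- The uniform superposition of the `(N - k - 1)!` Hamiltonian cycles on `k, …, N - 1`. -/
noncomputable def uniformFrom (N k : ℕ) : (Qubit N → Bool) → ℂ :=
  ((1 / Real.sqrt (((N - k - 1).factorial : ℕ) : ℝ) : ℝ) : ℂ) •
    ∑ σ ∈ cyclesFrom N k, ket (successors k σ)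

/-- Insertion of the new vertex `w` into a cycle `σ` that does not visit `w`, on the edge that
enters `j`: the edge `u → j` is replaced by `u → w → j`. In the successor encoding the entry
`j` is replaced by `w`, and the entry of `w` is `j`. -/
def insertVertex {N : ℕ} (w j : Fin N) (σ : Equiv.Perm (Fin N)) : Equiv.Perm (Fin N) :=
  Equiv.swap w j * σ

/-- Hadamard gates on all qubits of the register `w`. -/
def hadamards {N : ℕ} (w : Fin N) : Circuit (Qubit N) :=
  (List.finRange (width N)).map fun b => Gate.h (Sum.inl (w, b))

/-- With clean ancillas, the circuit multiplies by `exp (iφ)` exactly the basis states for which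
the number in register `w` satisfies `P`, and returns the ancillas clean. -/
def IsPhase {N : ℕ} (c : Circuit (Qubit N)) (w : Fin N) (P : ℕ → Prop) [DecidablePred P]
    (φ : ℝ) : Prop :=
  ∀ s : Fin N → ℕ, Fits s →
    c.run (ket s) = (if P (s w) then Complex.exp (φ * Complex.I) else 1) • ket s

/-- The building blocks of a circuit that performs the insertion recursion. Vertices are inserted
in the order `N - 3, N - 2, …, 0`, starting from the cycle on the vertices `N - 2, N - 1`.
For the insertion of `w`: `oracle w` and `zero w` are the two phase shifts in one Grover iteration,
`angle w` is their common angle, `iterations w` is the number of Grover iterations, `fix w` adjusts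
the global phase, and `replace w i` is the compare-and-replace module for register `i`. -/
structure Blocks (N : ℕ) : Type where
  prep : Circuit (Qubit N)
  oracle : Fin N → Circuit (Qubit N)
  zero : Fin N → Circuit (Qubit N)
  angle : Fin N → ℝ
  iterations : Fin N → ℕ
  fix : Fin N → Circuit (Qubit N)
  replace : Fin N → Fin N → Circuit (Qubit N)

namespace Blocks

/-- One Grover iteration on register `w`, as an operator `H S₀(φ) H S_χ(φ)`. -/
def grover {N : ℕ} (B : Blocks N) (w : Fin N) : Circuit (Qubit N) :=
  B.oracle w ++ hadamards w ++ B.zero w ++ hadamards w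

/-- Amplitude amplification on register `w`, up to the final adjustment of the global phase it is
the operator `G ^ n H`. -/
def amplify {N : ℕ} (B : Blocks N) (w : Fin N) : Circuit (Qubit N) :=
  hadamards w ++ (List.replicate (B.iterations w) (B.grover w)).flatten ++ B.fix w

/-- The insertion of the vertex `w`: amplitude amplification on register `w`, then one
compare-and-replace module for each of the registers `w + 1, …, N - 1`. -/
def step {N : ℕ} (B : Blocks N) (w : Fin N) : Circuit (Qubit N) :=
  B.amplify w ++ ((List.finRange N).filter fun i => w < i).flatMap (B.replace w)

/-- The circuit up to and including the insertion of the vertex `k`: first the preparation,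
then the insertions of `N - 3, N - 4, …, k`. -/
def stage {N : ℕ} (B : Blocks N) (k : ℕ) : Circuit (Qubit N) :=
  B.prep ++
    (((List.finRange N).filter fun w : Fin N => k ≤ (w : ℕ) ∧ (w : ℕ) + 2 < N).reverse).flatMap B.step

/-- The whole circuit. -/
def circuit {N : ℕ} (B : Blocks N) : Circuit (Qubit N) := B.stage 0

/-- The insertion of `w` prepares its register by exact amplitude amplification: with Grover
iterations whose phase shifts mark the numbers `w < j < N` and the number 0, respectively, it turns
`|0⟩` in register `w` into the uniform superposition of the `|j⟩`, `w < j < N`, with certainty. -/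
def ExactAmplification {N : ℕ} (B : Blocks N) (w : Fin N) : Prop :=
  (B.amplify w).ActsOn (register w ∪ ancillas N) ∧
  IsPhase (B.oracle w) w (fun j => (w : ℕ) < j ∧ j < N) (B.angle w) ∧
  IsPhase (B.zero w) w (fun j => j = 0) (B.angle w) ∧
  (∃ θ : ℝ, IsPhase (B.fix w) w (fun _ => True) θ) ∧
  ∀ s : Fin N → ℕ, Fits s → s w = 0 →
    (B.amplify w).run (ket s) =
      ((1 / Real.sqrt ((N : ℝ) - w - 1) : ℝ) : ℂ) •
        ∑ j ∈ Finset.Ioi w, ket (Function.update s w (j : ℕ))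

/-- The module for register `i` in the insertion of `w` is a reversible classical circuit on the
registers `w` and `i` and the ancillas: it compares the two registers, and if they hold the same
number, it replaces the number in register `i` by `w`. -/
def CompareReplace {N : ℕ} (B : Blocks N) (w i : Fin N) : Prop :=
  (B.replace w i).ActsOn (register w ∪ register i ∪ ancillas N) ∧
  (∀ g ∈ B.replace w i, g.IsMCX) ∧
  ∀ s : Fin N → ℕ, Fits s → (w : ℕ) < s w → s w < N → (w : ℕ) < s i → s i < N →
    (B.replace w i).run (ket s) =
      ket (Function.update s i (if s i = s w then (w : ℕ) else s i))

/-- The insertion of `w` is the coherent version of the recursion step: each Hamiltonian cycle on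
`w + 1, …, N - 1` is turned into the uniform superposition of its `N - w - 1` insertions of `w`. -/
def CoherentInsertion {N : ℕ} (B : Blocks N) (w : Fin N) : Prop :=
  ∀ σ ∈ cyclesFrom N (w + 1),
    (B.step w).run (ket (successors (w + 1) σ)) =
      ((1 / Real.sqrt ((N : ℝ) - w - 1) : ℝ) : ℂ) •
        ∑ j ∈ Finset.Ioi w, ket (successors w (insertVertex w j σ))

end Blocks

end HamCycle

/-! The combinatorial core: for w ≤ N-3, every Hamiltonian cycle on {w, …, N-1} arises from exactly
one pair (σ, j), where j is the successor of w and σ is the cycle with w cut out (`sum_cyclesFrom`).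
Hence insertion turns a uniform superposition of cycles into a uniform one, the factors 1/√(N-w-1)
multiply up to 1/√((N-1)!), and the same bijection counts the cycles.

In the successor encoding, inserting w means writing j into register w and overwriting by w the one
register that holds j. Register w is therefore prepared in the uniform superposition of all
admissible j, and the compare-and-replace modules do the overwriting. A single ancilla serves as
flag throughout. A module can erase its flag because all old entries exceed w: register i holds w
afterwards exactly when it was overwritten (`run_compareReplaceCircuit`).

The amplification is exact by phase matching. A Grover iteration preserves the plane spanned by the
marked and the unmarked basis sums (`run_grover_iterate`). With z = e^{iφ} and marked fraction p it
acts there as a 2×2 matrix of determinant z² and trace 2z cos ω, where sin(ω/2) = √p sin(φ/2). So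
the unmarked coefficient after n steps is z^n cos((n+1/2)ω)/cos(ω/2) (`groverCoeff_snd`). The number
n of order √N is fixed beforehand and φ is tuned so that ω = π/(2n+1), which makes this coefficient
vanish (`exists_angle_groverCoeff`). Unitarity then leaves only a global phase, removed by one R_Z
on a clean ancilla.

Gate count: N insertions, O(√N) iterations each, O(N) gates per iteration because the oracle marks
its numbers one by one; the replacements add O(N² log N). -/

namespace Gate

/-! ### Single gates: linearity and action on basis states. -/

variable {Q : Type} [DecidableEq Q]

theorem apply_add (g : Gate Q) (ψ φ : (Q → Bool) → ℂ) :
    g.apply (ψ + φ) = g.apply ψ + g.apply φ := by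
  cases g <;> funext x <;> simp only [apply, Pi.add_apply] <;> ring

theorem apply_smul (g : Gate Q) (c : ℂ) (ψ : (Q → Bool) → ℂ) :
    g.apply (c • ψ) = c • g.apply ψ := by
  cases g <;> funext x <;> simp only [apply, Pi.smul_apply, smul_eq_mul] <;> ring

/-- The action of a multi-controlled NOT gate on a bit string. -/
def flip (t : Q) (S : Finset Q) (v : Q → Bool) (x : Q → Bool) : Q → Bool :=
  if ∀ q ∈ S, x q = v q then Function.update x t (!(x t)) else x

theorem flip_flip (t : Q) (S : Finset Q) (v : Q → Bool) (ht : t ∉ S) (x : Q → Bool) :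
    flip t S v (flip t S v x) = x := by
  unfold flip
  by_cases h : ∀ q ∈ S, x q = v q
  · have h' : ∀ q ∈ S, Function.update x t (!(x t)) q = v q := by
      intro q hq
      rw [Function.update_of_ne (by rintro rfl; exact ht hq)]
      exact h q hq
    rw [if_pos h, if_pos h']
    simp
  · rw [if_neg h, if_neg h]

/-- `Gate.apply` pulls amplitudes back along the flip; since the flip is an involution, this pushes
basis states forward along it. -/
theorem apply_mcx_single [Fintype Q] (t : Q) (S : Finset Q) (v : Q → Bool) (ht : t ∉ S) (x : Q → Bool) :
    (mcx t S v ht).apply (Pi.single x (1 : ℂ)) = Pi.single (flip t S v x) 1 := by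
  funext y
  change (Pi.single x (1 : ℂ) : (Q → Bool) → ℂ) (flip t S v y) = _
  simp only [Pi.single_apply]
  congr 1
  apply propext
  constructor
  · rintro rfl; rw [flip_flip t S v ht]
  · rintro rfl; rw [flip_flip t S v ht]

theorem apply_rz_single [Fintype Q] (θ : ℝ) (q : Q) (x : Q → Bool) :
    (rz θ q).apply (Pi.single x (1 : ℂ)) =
      (if x q then Complex.exp ((θ / 2 : ℝ) * Complex.I)
        else Complex.exp (-((θ / 2 : ℝ) * Complex.I))) • Pi.single x 1 := by
  funext y
  by_cases h : y = x
  · subst h; simp [apply]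
  · simp [apply, h]

end Gate

/-! ### Circuits: linearity, Hadamard layers on product states, layers of controlled NOTs. -/

namespace Circuit

theorem ActsOn.append {Q : Type} {c d : Circuit Q} {S : Set Q} (hc : c.ActsOn S) (hd : d.ActsOn S) :
    ActsOn (c ++ d) S := by
  intro g hg
  rcases List.mem_append.1 hg with h | h
  exacts [hc g h, hd g h]

theorem ActsOn.flatten_replicate {Q : Type} {c : Circuit Q} {S : Set Q} (hc : c.ActsOn S) (n : ℕ) :
    ActsOn (List.replicate n c).flatten S := by
  intro g hg
  obtain ⟨l, hl, hg⟩ := List.mem_flatten.1 hg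
  rw [List.eq_of_mem_replicate hl] at hg
  exact hc g hg

variable {Q : Type} [DecidableEq Q]

@[simp] theorem run_nil (ψ : (Q → Bool) → ℂ) : run [] ψ = ψ := rfl

@[simp] theorem run_cons (g : Gate Q) (c : Circuit Q) (ψ : (Q → Bool) → ℂ) :
    run (g :: c) ψ = run c (g.apply ψ) := rfl

theorem run_append (c d : Circuit Q) (ψ : (Q → Bool) → ℂ) :
    run (c ++ d) ψ = run d (run c ψ) := by
  simp [run, List.foldl_append]

theorem run_add (c : Circuit Q) (ψ φ : (Q → Bool) → ℂ) :
    run c (ψ + φ) = run c ψ + run c φ := by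
  induction c generalizing ψ φ with
  | nil => rfl
  | cons g c ih => simp only [run_cons, Gate.apply_add, ih]

theorem run_smul (c : Circuit Q) (a : ℂ) (ψ : (Q → Bool) → ℂ) :
    run c (a • ψ) = a • run c ψ := by
  induction c generalizing ψ with
  | nil => rfl
  | cons g c ih => simp only [run_cons, Gate.apply_smul, ih]

theorem run_zero (c : Circuit Q) : run c 0 = 0 := by
  simpa using run_smul c 0 0

theorem run_sum {ι : Type*} (c : Circuit Q) (s : Finset ι) (f : ι → (Q → Bool) → ℂ) :
    run c (∑ i ∈ s, f i) = ∑ i ∈ s, run c (f i) := by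
  classical
  induction s using Finset.induction_on with
  | empty => simp [run_zero]
  | insert a s ha ih => rw [Finset.sum_insert ha, Finset.sum_insert ha, run_add, ih]

theorem run_replicate (n : ℕ) (c : Circuit Q) (ψ : (Q → Bool) → ℂ) :
    run (List.replicate n c).flatten ψ = (run c)^[n] ψ := by
  induction n generalizing ψ with
  | zero => rfl
  | succ n ih => simp [List.replicate_succ, run_append, ih]

/-- The state of a register of independent qubits. -/
def productState [Fintype Q] (f : Q → Bool → ℂ) (x : Q → Bool) : ℂ := ∏ q, f q (x q)

/-- The Hadamard gate on a single qubit. -/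
noncomputable def hadamard (f : Bool → ℂ) (b : Bool) : ℂ :=
  (f false + (if b then -1 else 1) * f true) / (Real.sqrt 2 : ℂ)

theorem sqrt_two_mul_self : (Real.sqrt 2 : ℂ) * (Real.sqrt 2 : ℂ) = 2 := by
  rw [← Complex.ofReal_mul, Real.mul_self_sqrt (by norm_num)]; norm_num

theorem sqrt_two_ne_zero : (Real.sqrt 2 : ℂ) ≠ 0 := by
  intro h
  have := sqrt_two_mul_self
  rw [h] at this
  norm_num at this

theorem hadamard_hadamard (f : Bool → ℂ) : hadamard (hadamard f) = f := by
  have h2 := sqrt_two_mul_self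
  have h0 := sqrt_two_ne_zero
  funext b
  cases b <;> simp only [hadamard, if_true, if_false, Bool.false_eq_true] <;> field_simp <;>
    rw [pow_two, h2] <;> ring

/-- Hadamard gates keep product states product, so a whole layer applied to a basis state reduces to
independent single-qubit computations. -/
theorem apply_h_productState [Fintype Q] (q : Q) (f : Q → Bool → ℂ) :
    (Gate.h q).apply (productState f) =
      productState (Function.update f q (hadamard (f q))) := by
  funext x
  have key : ∀ (f' : Q → Bool → ℂ) (c : Bool), productState f' (Function.update x q c) =
      f' q c * ∏ r ∈ Finset.univ.erase q, f' r (x r) := by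
    intro f' c
    rw [productState, ← Finset.mul_prod_erase _ _ (Finset.mem_univ q)]
    congr 1
    · simp
    · exact Finset.prod_congr rfl fun r hr => by
        rw [Function.update_of_ne (Finset.ne_of_mem_erase hr)]
  have h1 := key (Function.update f q (hadamard (f q))) (x q)
  rw [Function.update_eq_self] at h1
  rw [h1]
  simp only [Gate.apply, key, Function.update_self]
  have h2 : ∏ r ∈ Finset.univ.erase q, Function.update f q (hadamard (f q)) r (x r) =
      ∏ r ∈ Finset.univ.erase q, f r (x r) :=
    Finset.prod_congr rfl fun r hr => by
      rw [Function.update_of_ne (Finset.ne_of_mem_erase hr)]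
  rw [h2]
  simp only [hadamard]
  ring

theorem run_map_h_productState [Fintype Q] (L : List Q) (hL : L.Nodup) (f : Q → Bool → ℂ) :
    run (L.map Gate.h) (productState f) =
      productState fun q => if q ∈ L then hadamard (f q) else f q := by
  induction L generalizing f with
  | nil => simp
  | cons a L ih =>
    rw [List.nodup_cons] at hL
    rw [List.map_cons, run_cons, apply_h_productState, ih hL.2]
    congr 1
    funext q
    by_cases h : q = a
    · subst h; simp [hL.1]
    · simp [h]

theorem single_eq_productState {Q : Type} [Fintype Q] (x : Q → Bool) :
    (Pi.single x 1 : (Q → Bool) → ℂ) = productState fun q => Pi.single (x q) 1 := by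
  funext y
  simp only [productState, Pi.single_apply]
  rw [Fintype.prod_ite_zero]
  simp [funext_iff]

theorem run_map_h_involutive [Fintype Q] (L : List Q) (hL : L.Nodup) (x : Q → Bool) :
    run (L.map Gate.h) (run (L.map Gate.h) (Pi.single x 1)) = Pi.single x 1 := by
  rw [single_eq_productState, run_map_h_productState L hL, run_map_h_productState L hL]
  congr 1
  funext q
  by_cases h : q ∈ L <;> simp [h, hadamard_hadamard]

/-- A layer of multi-controlled NOT gates none of whose targets is a control of the layer. -/
theorem run_map_mcx {ι : Type} [Fintype Q] (t : ι → Q) (ht : Function.Injective t)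
    (S : ι → Finset Q) (v : ι → Q → Bool) (hS : ∀ b c, t c ∉ S b) (L : List ι) (hL : L.Nodup)
    (x y : Q → Bool) (hy : ∀ q, (∀ b ∈ L, q ≠ t b) → y q = x q)
    (hyt : ∀ b ∈ L, y (t b) = (x (t b) ^^ decide (∀ q ∈ S b, x q = v b q))) :
    run (L.map fun b => Gate.mcx (t b) (S b) (v b) (hS b b)) (Pi.single x 1) =
      Pi.single y 1 := by
  induction L generalizing x with
  | nil =>
    have : y = x := funext fun q => hy q (by simp)
    simp [this]
  | cons a L ih =>
    rw [List.nodup_cons] at hL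
    rw [List.map_cons, run_cons, Gate.apply_mcx_single]
    have hne : ∀ q, q ≠ t a → Gate.flip (t a) (S a) (v a) x q = x q := by
      intro q hq
      unfold Gate.flip
      split_ifs
      · rw [Function.update_of_ne hq]
      · rfl
    have heq : Gate.flip (t a) (S a) (v a) x (t a) =
        (x (t a) ^^ decide (∀ q ∈ S a, x q = v a q)) := by
      unfold Gate.flip
      by_cases h : ∀ q ∈ S a, x q = v a q
      · rw [if_pos h, decide_eq_true h]; simp
      · rw [if_neg h, decide_eq_false h]; simp
    refine ih hL.2 _ ?_ ?_
    · intro q hq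
      by_cases hqa : q = t a
      · subst hqa
        rw [heq, hyt a (by simp)]
      · rw [hne q hqa]
        refine hy q fun b hb => ?_
        rcases List.mem_cons.1 hb with rfl | hb
        exacts [hqa, hq b hb]
    · intro b hb
      have hba : t b ≠ t a := fun h => hL.1 (ht h ▸ hb)
      rw [hne _ hba, hyt b (List.mem_cons_of_mem _ hb)]
      -- The first gate changed only its target, which is no control of the layer, so later gates
      -- read the original values.
      congr 2
      apply propext
      refine forall₂_congr fun q hq => ?_
      rw [hne q (by rintro rfl; exact hS b a hq)]

end Circuit

/-! ### Marking numbers with an ancilla flag, and phase shifts built from it. -/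

namespace HamCycle

theorem forall_testBit_iff {m a b : ℕ} (ha : a < 2 ^ m) (hb : b < 2 ^ m) :
    (∀ i : Fin m, a.testBit i = b.testBit i) ↔ a = b := by
  refine ⟨fun h => Nat.eq_of_testBit_eq fun i => ?_, fun h _ => by rw [h]⟩
  by_cases hi : i < m
  · exact h ⟨i, hi⟩
  · have him : 2 ^ m ≤ 2 ^ i := Nat.pow_le_pow_right (by norm_num) (by omega)
    rw [Nat.testBit_lt_two_pow (ha.trans_le him), Nat.testBit_lt_two_pow (hb.trans_le him)]

variable {N : ℕ}

/-- The registers hold the numbers `s i`, the ancilla `a` holds `c`, and all others are 0. -/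
def flagged (s : Fin N → ℕ) (a : Fin (width N)) (c : Bool) : Qubit N → Bool :=
  Function.update (encode s) (Sum.inr a) c

theorem flagged_false (s : Fin N → ℕ) (a : Fin (width N)) : flagged s a false = encode s := by
  rw [flagged, Function.update_eq_self_iff]
  rfl

@[simp] theorem flagged_inl (s : Fin N → ℕ) (a : Fin (width N)) (c : Bool)
    (p : Fin N × Fin (width N)) : flagged s a c (Sum.inl p) = (s p.1).testBit p.2 := by
  rw [flagged, Function.update_of_ne (by simp)]
  rfl

@[simp] theorem flagged_inr_self (s : Fin N → ℕ) (a : Fin (width N)) (c : Bool) :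
    flagged s a c (Sum.inr a) = c := by
  simp [flagged]

theorem flagged_inr (s s' : Fin N → ℕ) (a b : Fin (width N)) (c : Bool) :
    flagged s a c (Sum.inr b) = flagged s' a c (Sum.inr b) := by
  by_cases h : b = a
  · subst h; simp
  · simp [flagged, h, encode]

/-- The qubits of the register `i` as a finite set. -/
def registerFinset (i : Fin N) : Finset (Qubit N) :=
  Finset.univ.image fun b => Sum.inl (i, b)

theorem inr_notMem_registerFinset (a : Fin (width N)) (i : Fin N) :
    (Sum.inr a : Qubit N) ∉ registerFinset i := by
  simp [registerFinset]

theorem forall_registerFinset_flagged_iff {s : Fin N → ℕ} (hs : Fits s) {j : ℕ}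
    (hj : j < 2 ^ width N) (i : Fin N) (a : Fin (width N)) (c : Bool) :
    (∀ q ∈ registerFinset i, flagged s a c q = encode (fun _ => j) q) ↔ s i = j := by
  rw [← forall_testBit_iff (hs i) hj]
  simp [registerFinset, encode]

/-- Flip the ancilla `a` if the register `i` holds the number `j`. -/
def markGate (i : Fin N) (a : Fin (width N)) (j : ℕ) : Gate (Qubit N) :=
  Gate.mcx (Sum.inr a) (registerFinset i) (encode fun _ => j) (inr_notMem_registerFinset a i)

theorem qubits_markGate (i : Fin N) (a : Fin (width N)) (j : ℕ) :
    (markGate i a j).qubits ⊆ register i ∪ ancillas N := by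
  intro q hq
  rcases hq with rfl | hq
  · exact Or.inr ⟨a, rfl⟩
  · obtain ⟨b, -, rfl⟩ := Finset.mem_image.1 (show q ∈ registerFinset i from hq)
    exact Or.inl ⟨b, rfl⟩

theorem apply_markGate {s : Fin N → ℕ} (hs : Fits s) {j : ℕ} (hj : j < 2 ^ width N)
    (i : Fin N) (a : Fin (width N)) (c : Bool) :
    (markGate i a j).apply (Pi.single (flagged s a c) 1) =
      Pi.single (flagged s a (c ^^ decide (s i = j))) 1 := by
  rw [markGate, Gate.apply_mcx_single]
  congr 1
  unfold Gate.flip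
  by_cases h : s i = j
  · rw [if_pos ((forall_registerFinset_flagged_iff hs hj i a c).2 h), decide_eq_true h]
    simp [flagged]
  · rw [if_neg (fun h' => h ((forall_registerFinset_flagged_iff hs hj i a c).1 h')),
      decide_eq_false h]
    simp

/-- The list has no repetitions, so at most one of the gates fires and the flag records membership.
-/
theorem run_map_markGate {s : Fin N → ℕ} (hs : Fits s) (i : Fin N) (a : Fin (width N))
    (L : List ℕ) (hL : L.Nodup) (hlt : ∀ j ∈ L, j < 2 ^ width N) (c : Bool) :
    Circuit.run (L.map (markGate i a)) (Pi.single (flagged s a c) 1) =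
      Pi.single (flagged s a (c ^^ decide (s i ∈ L))) 1 := by
  induction L generalizing c with
  | nil => simp
  | cons j L ih =>
    rw [List.nodup_cons] at hL
    rw [List.map_cons, Circuit.run_cons, apply_markGate hs (hlt j (by simp)),
      ih hL.2 fun k hk => hlt k (by simp [hk])]
    by_cases h : s i = j
    · subst h; simp [hL.1]
    · simp [h]

/-- Multiply by `exp (iφ)` the basis states for which the number in register `i` is in `L`. -/
def phaseCircuit (i : Fin N) (a : Fin (width N)) (L : List ℕ) (φ : ℝ) : Circuit (Qubit N) :=
  [Gate.rz (-φ) (Sum.inr a)] ++ L.map (markGate i a) ++ [Gate.rz φ (Sum.inr a)] ++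
    L.map (markGate i a)

theorem length_phaseCircuit (i : Fin N) (a : Fin (width N)) (L : List ℕ) (φ : ℝ) :
    (phaseCircuit i a L φ).length = 2 * L.length + 2 := by
  simp [phaseCircuit]; ring

theorem actsOn_phaseCircuit (i : Fin N) (a : Fin (width N)) (L : List ℕ) (φ : ℝ) :
    (phaseCircuit i a L φ).ActsOn (register i ∪ ancillas N) := by
  have hz : ∀ θ : ℝ, Circuit.ActsOn [Gate.rz θ (Sum.inr a)] (register i ∪ ancillas N) := by
    intro θ g hg
    rw [List.mem_singleton] at hg
    subst hg
    exact Set.singleton_subset_iff.2 (Or.inr ⟨a, rfl⟩)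
  have hm : Circuit.ActsOn (L.map (markGate i a)) (register i ∪ ancillas N) := by
    intro g hg
    obtain ⟨j, -, rfl⟩ := List.mem_map.1 hg
    exact qubits_markGate i a j
  exact (((hz _).append hm).append (hz _)).append hm

/-- The clean flag picks up e^{iφ/2} from R_Z(-φ). After marking, R_Z(φ) contributes e^{iφ/2} if the
flag is set and e^{-iφ/2} if not, for a total of e^{iφ} or 1; the second round of marking clears the
flag. -/
theorem isPhase_phaseCircuit (i : Fin N) (a : Fin (width N)) (L : List ℕ) (hL : L.Nodup)
    (hlt : ∀ j ∈ L, j < 2 ^ width N) (P : ℕ → Prop) [DecidablePred P] (hP : ∀ j, j ∈ L ↔ P j)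
    (φ : ℝ) : IsPhase (phaseCircuit i a L φ) i P φ := by
  intro s hs
  have hmark := run_map_markGate hs i a L hL hlt
  rw [ket, ← flagged_false s a]
  simp only [phaseCircuit, Circuit.run_append, Circuit.run_cons, Circuit.run_nil,
    Gate.apply_rz_single, flagged_inr_self, Circuit.run_smul, hmark, hP,
    Bool.false_xor, smul_smul, Bool.xor_self]
  by_cases h : P (s i)
  · simp only [h, decide_true, if_true, Bool.false_eq_true, if_false]
    rw [← Complex.exp_add]
    congr 2
    push_cast
    ring
  · simp only [h, decide_false, if_false, Bool.false_eq_true]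
    rw [← Complex.exp_add]
    congr 1
    rw [← Complex.exp_zero]
    congr 1
    push_cast
    ring

theorem isPhase_rz_ancilla (i : Fin N) (a : Fin (width N)) (θ : ℝ) :
    IsPhase [Gate.rz (-(2 * θ)) (Sum.inr a)] i (fun _ => True) θ := by
  intro s _
  rw [ket, Circuit.run_cons, Circuit.run_nil, Gate.apply_rz_single]
  simp only [encode, Bool.false_eq_true, if_false, if_true]
  congr 2
  push_cast
  ring

end HamCycle

/-! ### Grover iteration with matched phases as a two-dimensional recursion. -/

namespace HamCycle

/-- One Grover iteration in the plane spanned by the marked and the unmarked part of the uniform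
state: the coefficients after `n` iterations, for the phase factor `z` and the marked fraction `p`
of all basis states. -/
noncomputable def groverCoeff (z : ℂ) (p : ℝ) : ℕ → ℂ × ℂ
  | 0 => (1, 1)
  | n + 1 =>
    let c := groverCoeff z p n
    let d := (z - 1) * (z * c.1 * p + c.2 * (1 - p))
    (z * c.1 + d, c.2 + d)

/-- By Cayley–Hamilton both coefficients satisfy x(k+2) = T x(k+1) - z² x(k), where z² is the
determinant of one step and T = (z-1)²p + 2z its trace. The hypothesis `h` says T = 2z cos ω, so up
to the factor z^n this is the recursion of cos((n+1/2)ω). -/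
theorem groverCoeff_snd (z : ℂ) (p ω : ℝ) (hω : Real.cos (ω / 2) ≠ 0)
    (h : (z - 1) ^ 2 * p = (2 * Real.cos ω - 2 : ℝ) * z) (n : ℕ) :
    (groverCoeff z p n).2 = z ^ n * (Real.cos ((n + 1 / 2) * ω) / Real.cos (ω / 2) : ℝ) := by
  have hrec : ∀ k : ℕ, (groverCoeff z p (k + 2)).2 =
      (2 * Real.cos ω : ℝ) * z * (groverCoeff z p (k + 1)).2 - z ^ 2 * (groverCoeff z p k).2 := by
    intro k
    have h' : ((2 * Real.cos ω : ℝ) : ℂ) * z = (z - 1) ^ 2 * p + 2 * z := by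
      rw [h]; push_cast; ring
    rw [h']
    simp only [groverCoeff]
    ring
  have hcos : ∀ t : ℝ, Real.cos (t + ω) = 2 * Real.cos ω * Real.cos t - Real.cos (t - ω) := by
    intro t
    rw [Real.cos_add, Real.cos_sub]; ring
  induction n using Nat.twoStepInduction with
  | zero =>
    have : ((0 : ℕ) + 1 / 2 : ℝ) * ω = ω / 2 := by push_cast; ring
    rw [this, div_self hω]
    simp [groverCoeff]
  | one =>
    have h1 : ((1 : ℕ) + 1 / 2 : ℝ) * ω = ω / 2 + ω := by push_cast; ring
    have h2 : ω / 2 - ω = -(ω / 2) := by ring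
    have h3 : (2 * Real.cos ω * Real.cos (ω / 2) - Real.cos (ω / 2)) / Real.cos (ω / 2) =
        2 * Real.cos ω - 2 + 1 := by
      field_simp; ring
    rw [h1, hcos, h2, Real.cos_neg, h3]
    simp only [groverCoeff]
    have : z ^ 1 * ((2 * Real.cos ω - 2 + 1 : ℝ) : ℂ) = (z - 1) ^ 2 * p + z := by
      rw [h]; push_cast; ring
    rw [this]
    ring
  | more k ih0 ih1 =>
    rw [hrec, ih0, ih1]
    have h1 : ((k + 2 : ℕ) + 1 / 2 : ℝ) * ω = ((k + 1 : ℕ) + 1 / 2 : ℝ) * ω + ω := by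
      push_cast; ring
    have h2 : ((k : ℕ) + 1 / 2 : ℝ) * ω = ((k + 1 : ℕ) + 1 / 2 : ℝ) * ω - ω := by
      push_cast; ring
    rw [h1, hcos, h2]
    push_cast
    ring

/-- Unitarity in the plane: the marked and unmarked sums have squared norms in the proportion p to
1-p. -/
theorem groverCoeff_norm (z : ℂ) (hz : z * star z = 1) (p : ℝ) (n : ℕ) :
    p * ((groverCoeff z p n).1 * star (groverCoeff z p n).1) +
      (1 - p) * ((groverCoeff z p n).2 * star (groverCoeff z p n).2) = 1 := by
  induction n with
  | zero => simp [groverCoeff]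
  | succ n ih =>
    refine Eq.trans ?_ ih
    simp only [groverCoeff]
    generalize (groverCoeff z p n).1 = a
    generalize (groverCoeff z p n).2 = r
    have hp : star (p : ℂ) = p := Complex.conj_ofReal p
    simp only [star_add, star_mul', star_sub, star_one, hp]
    -- With m the mean amplitude after the oracle, the step adds (z-1)m to both coefficients. The
    -- squared norm changes by (p|a|² + |m|²)(|z|² - 1), which is zero.
    linear_combination
      (p * (a * star a) + (p * (z * a) + (1 - p) * r) *
        (p * (star z * star a) + (1 - p) * star r)) * hz

/-- For a suitable angle the unmarked part vanishes after `n` iterations. -/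
theorem exists_angle_groverCoeff (p : ℝ) (hp : 0 < p) (n : ℕ) (hn : 1 ≤ n)
    (h : Real.sin (Real.pi / (2 * n + 1) / 2) ≤ Real.sqrt p) :
    ∃ φ θ : ℝ, groverCoeff (Complex.exp (φ * Complex.I)) p n =
      (Complex.exp (θ * Complex.I) * (1 / Real.sqrt p : ℝ), 0) := by
  set ω : ℝ := Real.pi / (2 * n + 1) with hωdef
  have hn' : (1 : ℝ) ≤ n := by exact_mod_cast hn
  have hπ := Real.pi_pos
  have hω0 : 0 < ω := by positivity
  have hωπ : ω < Real.pi := by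
    rw [hωdef, div_lt_iff₀ (by positivity)]
    nlinarith
  have hc : Real.cos (ω / 2) ≠ 0 :=
    (Real.cos_pos_of_mem_Ioo ⟨by linarith, by linarith⟩).ne'
  have hsp : 0 < Real.sqrt p := Real.sqrt_pos.2 hp
  have hs0 : 0 ≤ Real.sin (ω / 2) :=
    Real.sin_nonneg_of_nonneg_of_le_pi (by linarith) (by linarith)
  -- Since (z-1)² = -4 sin²(φ/2) z, the trace condition of `groverCoeff_snd` reads √p sin(φ/2) =
  -- sin(ω/2). The hypothesis `h` is what makes this solvable.
  set φ : ℝ := 2 * Real.arcsin (Real.sin (ω / 2) / Real.sqrt p) with hφdef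
  have hφ : Real.sin (φ / 2) = Real.sin (ω / 2) / Real.sqrt p := by
    rw [hφdef, mul_div_cancel_left₀ _ two_ne_zero, Real.sin_arcsin]
    · exact le_trans (by norm_num) (div_nonneg hs0 hsp.le)
    · rwa [div_le_one hsp]
  have hφ2 : p * (2 - 2 * Real.cos φ) = 2 - 2 * Real.cos ω := by
    have h1 : Real.cos φ = 1 - 2 * Real.sin (φ / 2) ^ 2 := by
      have := Real.cos_two_mul (φ / 2)
      rw [mul_div_cancel₀ _ two_ne_zero, Real.cos_sq'] at this
      rw [this]; ring
    have h2 : Real.cos ω = 1 - 2 * Real.sin (ω / 2) ^ 2 := by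
      have := Real.cos_two_mul (ω / 2)
      rw [mul_div_cancel₀ _ two_ne_zero, Real.cos_sq'] at this
      rw [this]; ring
    rw [h1, h2, hφ, div_pow, Real.sq_sqrt hp.le]
    field_simp
    ring
  set z : ℂ := Complex.exp (φ * Complex.I) with hzdef
  have hz : z * star z = 1 := by
    have : star z = Complex.exp (-(φ * Complex.I)) := by
      rw [hzdef, Complex.star_def, ← Complex.exp_conj]
      simp
    rw [this, hzdef, ← Complex.exp_add]
    simp
  have hz2 : z ^ 2 + 1 = (2 * Real.cos φ : ℝ) * z := by
    have h1 : ((2 * Real.cos φ : ℝ) : ℂ) = z + star z := by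
      rw [Complex.star_def, Complex.add_conj, hzdef, Complex.exp_ofReal_mul_I_re]
    rw [h1, add_mul, mul_comm (star z), hz]; ring
  have hz3 : (z - 1) ^ 2 * p = (2 * Real.cos ω - 2 : ℝ) * z := by
    have h1 : (z - 1) ^ 2 = (2 * Real.cos φ - 2 : ℝ) * z := by
      push_cast at hz2 ⊢
      linear_combination hz2
    have h2 : ((2 * Real.cos ω - 2 : ℝ) : ℂ) = (p * (2 * Real.cos φ - 2) : ℝ) := by
      congr 1; linarith
    rw [h1, h2]; push_cast; ring
  have hr : (groverCoeff z p n).2 = 0 := by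
    rw [groverCoeff_snd z p ω hc hz3]
    have : ((n : ℝ) + 1 / 2) * ω = Real.pi / 2 := by
      rw [hωdef]; field_simp
    rw [this, Real.cos_pi_div_two]
    simp
  have hnorm := groverCoeff_norm z hz p n
  rw [hr] at hnorm
  set a := (groverCoeff z p n).1 with ha
  have hna : p * ‖a‖ ^ 2 = 1 := by
    rw [Complex.star_def, Complex.mul_conj, Complex.normSq_eq_norm_sq] at hnorm
    simp only [zero_mul, mul_zero, add_zero] at hnorm
    exact_mod_cast hnorm
  have hna' : ‖a‖ = 1 / Real.sqrt p := by
    rw [one_div, ← Real.sqrt_inv, eq_comm, Real.sqrt_eq_iff_mul_self_eq (by positivity) (by positivity)]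
    field_simp
    linarith
  -- Norm conservation fixes the modulus of the marked coefficient, so only its argument θ remains
  -- free.
  refine ⟨φ, Complex.arg a, Prod.ext ?_ hr⟩
  change a = _
  rw [← hna', mul_comm, Complex.norm_mul_exp_arg_mul_I]

end HamCycle

/-! ### Hadamards on one register and the Grover operator on states. -/

namespace HamCycle

variable {N : ℕ}

theorem fits_update {s : Fin N → ℕ} (hs : Fits s) (w : Fin N) {l : ℕ} (hl : l < 2 ^ width N) :
    Fits (Function.update s w l) := by
  intro i
  by_cases h : i = w
  · subst h; simpa using hl
  · simpa [h] using hs i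

theorem encode_update_self (s : Fin N → ℕ) (w : Fin N) (l : ℕ) (b : Fin (width N)) :
    encode (Function.update s w l) (Sum.inl (w, b)) = l.testBit b := by
  simp [encode]

theorem encode_update_of_notMem (s : Fin N → ℕ) (w : Fin N) (l : ℕ) {q : Qubit N}
    (hq : q ∉ registerFinset w) : encode (Function.update s w l) q = encode s q := by
  rcases q with ⟨i, b⟩ | b
  · have : i ≠ w := by
      rintro rfl
      exact hq (Finset.mem_image_of_mem _ (Finset.mem_univ b))
    simp [encode, this]
  · rfl

/-- A state supported on the strings that agree with `encode s` off the register `w` is a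
superposition of the strings with a number in register `w`. -/
theorem eq_sum_ket_update (s : Fin N → ℕ) (w : Fin N) (ψ : (Qubit N → Bool) → ℂ)
    (hψ : ∀ x q, q ∉ registerFinset w → x q ≠ encode s q → ψ x = 0) :
    ψ = ∑ l ∈ Finset.range (2 ^ width N),
      ψ (encode (Function.update s w l)) • ket (Function.update s w l) := by
  funext x
  simp only [Finset.sum_apply, Pi.smul_apply, smul_eq_mul, ket, Pi.single_apply, mul_ite,
    mul_one, mul_zero]
  by_cases hx : ∀ q, q ∉ registerFinset w → x q = encode s q
  · set l₀ := Nat.ofBits fun b : Fin (width N) => x (Sum.inl (w, b)) with hl₀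
    have hx₀ : x = encode (Function.update s w l₀) := by
      funext q
      by_cases hq : q ∈ registerFinset w
      · obtain ⟨b, -, rfl⟩ := Finset.mem_image.1 hq
        rw [encode_update_self, hl₀, Nat.testBit_ofBits_lt _ _ b.2]
      · rw [encode_update_of_notMem _ _ _ hq, hx q hq]
    rw [Finset.sum_eq_single l₀]
    · rw [if_pos hx₀, ← hx₀]
    · intro l hl hne
      rw [if_neg]
      rw [hx₀]
      intro h
      refine hne ((forall_testBit_iff (Finset.mem_range.1 hl) (Nat.ofBits_lt_two_pow _)).1 ?_)
      intro b
      have := congrFun h (Sum.inl (w, b))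
      rw [encode_update_self, encode_update_self] at this
      exact this.symm
    · intro h
      exact absurd (Finset.mem_range.2 (Nat.ofBits_lt_two_pow _)) h
  · push Not at hx
    obtain ⟨q, hq, hne⟩ := hx
    rw [hψ x q hq hne, eq_comm]
    refine Finset.sum_eq_zero fun l _ => if_neg ?_
    rintro rfl
    exact hne (encode_update_of_notMem _ _ _ hq)

/-- The qubits of the register `w` as a list. -/
def registerList (w : Fin N) : List (Qubit N) :=
  (List.finRange (width N)).map fun b => Sum.inl (w, b)

theorem nodup_registerList (w : Fin N) : (registerList w).Nodup :=
  (List.nodup_finRange _).map fun a b h => by simpa using h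

theorem mem_registerList {w : Fin N} {q : Qubit N} :
    q ∈ registerList w ↔ q ∈ registerFinset w := by
  simp [registerList, registerFinset]

theorem hadamards_eq (w : Fin N) : hadamards w = (registerList w).map Gate.h := by
  simp [hadamards, registerList]

theorem card_registerFinset (w : Fin N) : (registerFinset w).card = width N := by
  rw [registerFinset, Finset.card_image_of_injective _ fun a b h => by simpa using h]
  simp

theorem actsOn_hadamards (w : Fin N) : (hadamards w).ActsOn (register w ∪ ancillas N) := by
  intro g hg
  obtain ⟨b, -, rfl⟩ := List.mem_map.1 hg
  exact Set.singleton_subset_iff.2 (Or.inl ⟨b, rfl⟩)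

theorem run_hadamards_ket (w : Fin N) (s : Fin N → ℕ) :
    (hadamards w).run (ket s) = Circuit.productState fun q =>
      if q ∈ registerFinset w then Circuit.hadamard (Pi.single (encode s q) 1)
      else Pi.single (encode s q) 1 := by
  rw [hadamards_eq, ket, Circuit.single_eq_productState,
    Circuit.run_map_h_productState _ (nodup_registerList w)]
  simp only [mem_registerList]

theorem run_hadamards_hadamards_ket (w : Fin N) (s : Fin N → ℕ) :
    (hadamards w).run ((hadamards w).run (ket s)) = ket s := by
  rw [hadamards_eq]
  exact Circuit.run_map_h_involutive _ (nodup_registerList w) _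

/-- The general amplitude carries the sign (-1)^(number of common 1-bits). Only the sign-free case
is needed: the start or the target is 0. -/
theorem run_hadamards_ket_apply (w : Fin N) (s : Fin N → ℕ) (l : ℕ)
    (h : ∀ b : Fin (width N), ((s w).testBit b && l.testBit b) = false) :
    (hadamards w).run (ket s) (encode (Function.update s w l)) =
      (1 / Real.sqrt (2 ^ width N) : ℝ) := by
  rw [run_hadamards_ket, Circuit.productState]
  have : ∀ q : Qubit N, (if q ∈ registerFinset w then
      Circuit.hadamard (Pi.single (encode s q) 1) else Pi.single (encode s q) 1 : Bool → ℂ)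
      (encode (Function.update s w l) q) =
      if q ∈ registerFinset w then ((1 / Real.sqrt 2 : ℝ) : ℂ) else 1 := by
    intro q
    by_cases hq : q ∈ registerFinset w
    · rw [if_pos hq, if_pos hq]
      obtain ⟨b, -, rfl⟩ := Finset.mem_image.1 hq
      rw [encode_update_self]
      have hb := h b
      have he : encode s (Sum.inl (w, b)) = (s w).testBit b := rfl
      rw [he]
      cases h1 : (s w).testBit b <;> cases h2 : l.testBit b <;>
        simp_all [Circuit.hadamard]
    · rw [if_neg hq, if_neg hq, encode_update_of_notMem _ _ _ hq]
      simp
  rw [Finset.prod_congr rfl fun q _ => this q, Finset.prod_ite_mem, Finset.univ_inter,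
    Finset.prod_const, card_registerFinset, ← Complex.ofReal_pow, div_pow, one_pow,
    Real.sqrt_eq_rpow, Real.sqrt_eq_rpow, ← Real.rpow_natCast, ← Real.rpow_mul (by norm_num),
    ← Real.rpow_natCast 2 (width N), ← Real.rpow_mul (by norm_num), mul_comm]

theorem run_hadamards_ket_eq_sum (w : Fin N) (s : Fin N → ℕ) :
    (hadamards w).run (ket s) = ∑ l ∈ Finset.range (2 ^ width N),
      (hadamards w).run (ket s) (encode (Function.update s w l)) •
        ket (Function.update s w l) := by
  refine eq_sum_ket_update s w _ fun x q hq hne => ?_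
  rw [run_hadamards_ket, Circuit.productState]
  refine Finset.prod_eq_zero (Finset.mem_univ q) ?_
  rw [if_neg hq]
  exact Pi.single_eq_of_ne hne _

theorem run_hadamards_ket_of_eq_zero (w : Fin N) (s : Fin N → ℕ) (hw : s w = 0) :
    (hadamards w).run (ket s) = ((1 / Real.sqrt (2 ^ width N) : ℝ) : ℂ) •
      ∑ l ∈ Finset.range (2 ^ width N), ket (Function.update s w l) := by
  rw [run_hadamards_ket_eq_sum, Finset.smul_sum]
  refine Finset.sum_congr rfl fun l _ => ?_
  rw [run_hadamards_ket_apply w s l (by simp [hw])]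

/-- The operator `H S₀ H` is the phase rotation about the uniform state. -/
theorem run_diffusion {c : Circuit (Qubit N)} {w : Fin N} {φ : ℝ}
    (hc : IsPhase c w (fun j => j = 0) φ) {s : Fin N → ℕ} (hs : Fits s) :
    (hadamards w).run (c.run ((hadamards w).run (ket s))) =
      ket s + ((Complex.exp (φ * Complex.I) - 1) / (2 ^ width N : ℝ) : ℂ) •
        ∑ l ∈ Finset.range (2 ^ width N), ket (Function.update s w l) := by
  set z := Complex.exp (φ * Complex.I) with hz
  set r : ℂ := ((1 / Real.sqrt (2 ^ width N) : ℝ) : ℂ) with hr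
  have hr2 : r * r = 1 / (2 ^ width N : ℝ) := by
    rw [hr, ← Complex.ofReal_mul, div_mul_div_comm, Real.mul_self_sqrt (by positivity)]
    push_cast
    ring
  have h0 : 0 ∈ Finset.range (2 ^ width N) := Finset.mem_range.2 (by positivity)
  have hfits : Fits (Function.update s w 0) := fits_update hs w (by positivity)
  -- Only the component with 0 in register w is changed; the outer Hadamards then use H² = 1 on the
  -- first summand and spread the second one uniformly.
  have hphase : c.run ((hadamards w).run (ket s)) = (hadamards w).run (ket s) +
      ((z - 1) * r) • ket (Function.update s w 0) := by
    rw [run_hadamards_ket_eq_sum, Circuit.run_sum, ← Finset.add_sum_erase _ _ h0,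
      ← Finset.add_sum_erase _ _ h0, run_hadamards_ket_apply w s 0 (by simp), ← hr]
    have : ∀ l ∈ (Finset.range (2 ^ width N)).erase 0,
        c.run ((hadamards w).run (ket s) (encode (Function.update s w l)) •
          ket (Function.update s w l)) =
        (hadamards w).run (ket s) (encode (Function.update s w l)) •
          ket (Function.update s w l) := by
      intro l hl
      rw [Finset.mem_erase, Finset.mem_range] at hl
      rw [Circuit.run_smul, hc _ (fits_update hs w hl.2), Function.update_self, if_neg hl.1,
        one_smul]
    rw [Finset.sum_congr rfl this, Circuit.run_smul, hc _ hfits, Function.update_self, if_pos rfl,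
      ← hz]
    module
  rw [hphase, Circuit.run_add, run_hadamards_hadamards_ket, Circuit.run_smul,
    run_hadamards_ket_of_eq_zero w _ (by simp), ← hr, smul_smul, mul_assoc, hr2]
  simp only [Function.update_idem]
  rw [mul_one_div]

namespace Blocks

/-- The oracle scales the marked sum by z; the diffusion adds to the sum over any set U the multiple
|U|(z-1)/2^m of the full sum. Together these are one step of `groverCoeff`, started from the
unnormalised full sum. -/
theorem run_grover_iterate (B : Blocks N) (w : Fin N) (P : ℕ → Prop) [DecidablePred P] (φ : ℝ)
    (ho : IsPhase (B.oracle w) w P φ) (hz : IsPhase (B.zero w) w (fun j => j = 0) φ)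
    {s : Fin N → ℕ} (hs : Fits s) (n : ℕ) :
    (Circuit.run (B.grover w))^[n]
        (∑ l ∈ Finset.range (2 ^ width N), ket (Function.update s w l)) =
      (groverCoeff (Complex.exp (φ * Complex.I))
          (((Finset.range (2 ^ width N)).filter P).card / 2 ^ width N) n).1 •
        ∑ l ∈ (Finset.range (2 ^ width N)).filter P, ket (Function.update s w l) +
      (groverCoeff (Complex.exp (φ * Complex.I))
          (((Finset.range (2 ^ width N)).filter P).card / 2 ^ width N) n).2 •
        ∑ l ∈ (Finset.range (2 ^ width N)).filter (fun l => ¬ P l),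
          ket (Function.update s w l) := by
  have hsplit := Finset.sum_filter_add_sum_filter_not (Finset.range (2 ^ width N)) P
    fun l => ket (Function.update s w l)
  have hcard := Finset.card_filter_add_card_filter_not (s := Finset.range (2 ^ width N)) P
  rw [Finset.card_range] at hcard
  set S := (Finset.range (2 ^ width N)).filter P with hS
  set T := (Finset.range (2 ^ width N)).filter (fun l => ¬ P l) with hT
  set z := Complex.exp (φ * Complex.I) with hzdef
  set p : ℝ := (S.card : ℝ) / 2 ^ width N with hp
  have hD : (2 ^ width N : ℂ) ≠ 0 := pow_ne_zero _ two_ne_zero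
  have hcard' : (T.card : ℂ) = 2 ^ width N - S.card := by
    rw [eq_sub_iff_add_eq']
    exact_mod_cast hcard
  have hoS : (B.oracle w).run (∑ l ∈ S, ket (Function.update s w l)) =
      z • ∑ l ∈ S, ket (Function.update s w l) := by
    rw [Circuit.run_sum, Finset.smul_sum]
    refine Finset.sum_congr rfl fun l hl => ?_
    rw [hS, Finset.mem_filter, Finset.mem_range] at hl
    rw [ho _ (fits_update hs w hl.1), Function.update_self, if_pos hl.2]
  have hoT : (B.oracle w).run (∑ l ∈ T, ket (Function.update s w l)) =
      ∑ l ∈ T, ket (Function.update s w l) := by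
    rw [Circuit.run_sum]
    refine Finset.sum_congr rfl fun l hl => ?_
    rw [hT, Finset.mem_filter, Finset.mem_range] at hl
    rw [ho _ (fits_update hs w hl.1), Function.update_self, if_neg hl.2, one_smul]
  have hdiff : ∀ U ⊆ Finset.range (2 ^ width N),
      (hadamards w).run ((B.zero w).run ((hadamards w).run
        (∑ l ∈ U, ket (Function.update s w l)))) =
      ∑ l ∈ U, ket (Function.update s w l) + (U.card * (z - 1) / 2 ^ width N : ℂ) •
        (∑ l ∈ S, ket (Function.update s w l) + ∑ l ∈ T, ket (Function.update s w l)) := by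
    intro U hU
    rw [hsplit]
    simp only [Circuit.run_sum]
    rw [Finset.sum_congr rfl fun l hl => run_diffusion hz
      (fits_update hs w (Finset.mem_range.1 (hU hl))), Finset.sum_add_distrib]
    simp only [Function.update_idem, Finset.sum_const]
    rw [← Nat.cast_smul_eq_nsmul ℂ, smul_smul]
    push_cast
    rw [mul_div_assoc]
  induction n with
  | zero => simp [groverCoeff, hsplit]
  | succ n ih =>
    rw [Function.iterate_succ_apply', ih]
    simp only [grover, Circuit.run_append, Circuit.run_add, Circuit.run_smul, hoS, hoT,
      hdiff S (Finset.filter_subset _ _), hdiff T (Finset.filter_subset _ _), groverCoeff,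
      hcard']
    have hpc : (p : ℂ) = S.card / 2 ^ width N := by rw [hp]; push_cast; rfl
    rw [hpc]
    generalize (∑ l ∈ S, ket (Function.update s w l)) = g
    generalize (∑ l ∈ T, ket (Function.update s w l)) = b
    match_scalars <;> field_simp <;> ring

end Blocks

end HamCycle

/-! ### Compare-and-replace modules, the concrete blocks, exact amplification. -/

namespace HamCycle

variable {N : ℕ}

theorem inl_injective (i : Fin N) :
    Function.Injective fun b : Fin (width N) => (Sum.inl (i, b) : Qubit N) :=
  fun a b h => by simpa using h

/-- Add the register `w` bitwise modulo 2 to the register `i`. -/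
def xorCircuit (w i : Fin N) (h : i ≠ w) : Circuit (Qubit N) :=
  (List.finRange (width N)).map fun b =>
    Gate.mcx (Sum.inl (i, b)) {Sum.inl (w, b)} (fun _ => true) (by simp [h])

/-- If the ancilla `a` is set, add `r xor w` to the register `i` bitwise modulo 2, where `r` is
the content of the register `w`. -/
def flaggedXorCircuit (w i : Fin N) (a : Fin (width N)) (h : i ≠ w) : Circuit (Qubit N) :=
  (List.finRange (width N)).map fun b =>
    Gate.mcx (Sum.inl (i, b)) {Sum.inr a, Sum.inl (w, b)}
      (Sum.elim (fun _ => !(w : ℕ).testBit b) fun _ => true) (by simp [h])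

/-- Write the number `v` into the empty register `i`. -/
def writeCircuit (i : Fin N) (v : ℕ) : Circuit (Qubit N) :=
  ((List.finRange (width N)).filter fun b : Fin (width N) => v.testBit b).map fun b =>
    Gate.mcx (Sum.inl (i, b)) ∅ (fun _ => true) (by simp)

theorem run_xorCircuit (w i : Fin N) (h : i ≠ w) (s : Fin N → ℕ) (a : Fin (width N))
    (c : Bool) :
    (xorCircuit w i h).run (Pi.single (flagged s a c) 1) =
      Pi.single (flagged (Function.update s i (s i ^^^ s w)) a c) 1 := by
  refine Circuit.run_map_mcx _ (inl_injective i) _ _ (fun b c => by simp [h]) _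
    (List.nodup_finRange _) _ _ ?_ ?_
  · rintro (⟨k, b⟩ | b) hq
    · have : k ≠ i := by
        rintro rfl
        exact hq b (List.mem_finRange b) rfl
      simp [this]
    · exact flagged_inr _ _ _ _ _
  · intro b _
    simp

/-- The control on bit b of register w has the negated bit b of the constant w as polarity, so it
fires exactly where the content and the constant differ. -/
theorem run_flaggedXorCircuit (w i : Fin N) (h : i ≠ w) (s : Fin N → ℕ) (a : Fin (width N))
    (c : Bool) :
    (flaggedXorCircuit w i a h).run (Pi.single (flagged s a c) 1) =
      Pi.single (flagged (Function.update s i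
        (if c then s i ^^^ (s w ^^^ (w : ℕ)) else s i)) a c) 1 := by
  refine Circuit.run_map_mcx _ (inl_injective i) _ _ (fun b c => by simp [h]) _
    (List.nodup_finRange _) _ _ ?_ ?_
  · rintro (⟨k, b⟩ | b) hq
    · have : k ≠ i := by
        rintro rfl
        exact hq b (List.mem_finRange b) rfl
      simp [this]
    · exact flagged_inr _ _ _ _ _
  · intro b _
    cases c
    · simp
    · cases h1 : (s i).testBit b <;> cases h2 : (s w).testBit b <;>
        cases h3 : (w : ℕ).testBit b <;> simp [h1, h2, h3]

theorem run_writeCircuit (i : Fin N) (v : ℕ) (s : Fin N → ℕ) (hs : s i = 0) :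
    (writeCircuit i v).run (ket s) = ket (Function.update s i v) := by
  refine Circuit.run_map_mcx _ (inl_injective i) _ _ (fun b c => by simp) _
    ((List.nodup_finRange _).filter _) _ _ ?_ ?_
  · rintro (⟨k, b⟩ | b) hq
    · by_cases hk : k = i
      · subst hk
        have : v.testBit b = false := by
          by_contra hv
          exact hq b (List.mem_filter.2 ⟨List.mem_finRange b, by simpa using hv⟩) rfl
        simp [encode, hs, this]
      · simp [encode, hk]
    · rfl
  · intro b hb
    have : v.testBit b = true := by simpa using (List.mem_filter.1 hb).2
    simp [encode, hs, this]

/-- The compare-and-replace module: flag the equality of the registers `w` and `i`, replace the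
content of the register `i` if the flag is set, and clear the flag, which is set exactly if the
register `i` holds `w`. -/
def compareReplaceCircuit (w i : Fin N) (a : Fin (width N)) : Circuit (Qubit N) :=
  if h : i ≠ w then
    xorCircuit w i h ++ [markGate i a 0] ++ xorCircuit w i h ++ flaggedXorCircuit w i a h ++
      [markGate i a w]
  else []

theorem length_compareReplaceCircuit_le (w i : Fin N) (a : Fin (width N)) :
    (compareReplaceCircuit w i a).length ≤ 3 * width N + 2 := by
  unfold compareReplaceCircuit
  split_ifs
  · simp [xorCircuit, flaggedXorCircuit]; omega
  · simp

theorem actsOn_xorCircuit (w i : Fin N) (h : i ≠ w) :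
    (xorCircuit w i h).ActsOn (register w ∪ register i ∪ ancillas N) := by
  intro g hg
  obtain ⟨b, -, rfl⟩ := List.mem_map.1 hg
  rintro q (rfl | hq)
  · exact Or.inl (Or.inr ⟨b, rfl⟩)
  · simp only [Set.mem_ofPred_eq, Finset.mem_singleton] at hq
    exact Or.inl (Or.inl ⟨b, hq⟩)

theorem actsOn_flaggedXorCircuit (w i : Fin N) (a : Fin (width N)) (h : i ≠ w) :
    (flaggedXorCircuit w i a h).ActsOn (register w ∪ register i ∪ ancillas N) := by
  intro g hg
  obtain ⟨b, -, rfl⟩ := List.mem_map.1 hg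
  rintro q (rfl | hq)
  · exact Or.inl (Or.inr ⟨b, rfl⟩)
  · simp only [Set.mem_ofPred_eq, Finset.mem_insert, Finset.mem_singleton] at hq
    rcases hq with rfl | rfl
    · exact Or.inr ⟨a, rfl⟩
    · exact Or.inl (Or.inl ⟨b, rfl⟩)

theorem actsOn_compareReplaceCircuit (w i : Fin N) (a : Fin (width N)) :
    (compareReplaceCircuit w i a).ActsOn (register w ∪ register i ∪ ancillas N) := by
  have hm : ∀ j, Circuit.ActsOn [markGate i a j] (register w ∪ register i ∪ ancillas N) := by
    intro j g hg
    rw [List.mem_singleton] at hg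
    subst hg
    exact (qubits_markGate i a j).trans
      (Set.union_subset_union_left _ Set.subset_union_right)
  unfold compareReplaceCircuit
  split_ifs with h
  · have hx := actsOn_xorCircuit w i h
    exact (((hx.append (hm 0)).append hx).append (actsOn_flaggedXorCircuit w i a h)).append (hm w)
  · intro g hg
    simp at hg

theorem isMCX_of_mem_compareReplaceCircuit (w i : Fin N) (a : Fin (width N)) :
    ∀ g ∈ compareReplaceCircuit w i a, g.IsMCX := by
  intro g hg
  unfold compareReplaceCircuit at hg
  split_ifs at hg
  · simp only [xorCircuit, flaggedXorCircuit, List.mem_append, List.mem_map,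
      List.mem_singleton] at hg
    rcases hg with (((⟨_, -, rfl⟩ | rfl) | ⟨_, -, rfl⟩) | ⟨_, -, rfl⟩) | rfl <;> trivial
  · simp at hg

theorem width_pos (hN : 2 ≤ N) : 0 < width N := Nat.clog_pos (by norm_num) hN

theorem le_two_pow_width (N : ℕ) : N ≤ 2 ^ width N := Nat.le_pow_clog (by norm_num) N

theorem two_pow_width_le (hN : 2 ≤ N) : 2 ^ width N ≤ 2 * N := by
  have h := Nat.pow_pred_clog_lt_self (b := 2) (by norm_num) (x := N) (by omega)
  have hp := width_pos hN
  unfold width at *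
  obtain ⟨k, hk⟩ := Nat.exists_eq_succ_of_ne_zero hp.ne'
  rw [hk] at h ⊢
  rw [Nat.pow_succ]
  simp only [Nat.succ_eq_add_one, Nat.pred_eq_sub_one, Nat.add_sub_cancel] at h
  omega

theorem run_compareReplaceCircuit {w i : Fin N} (h : i ≠ w) (a : Fin (width N))
    {s : Fin N → ℕ} (hs : Fits s) (hi : (w : ℕ) < s i) :
    (compareReplaceCircuit w i a).run (ket s) =
      ket (Function.update s i (if s i = s w then (w : ℕ) else s i)) := by
  have hw : (w : ℕ) < 2 ^ width N := hi.trans (hs i)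
  have h1 : Fits (Function.update s i (s i ^^^ s w)) :=
    fits_update hs i (Nat.xor_lt_two_pow (hs i) (hs w))
  rw [compareReplaceCircuit, dif_pos h, ket, ← flagged_false s a]
  simp only [Circuit.run_append, Circuit.run_cons, Circuit.run_nil, run_xorCircuit,
    apply_markGate h1 (j := 0) (by positivity), run_flaggedXorCircuit, Function.update_self,
    Function.update_of_ne h.symm, Function.update_idem, Bool.false_xor, Nat.xor_assoc,
    Nat.xor_self, Nat.xor_zero, Nat.xor_eq_zero_iff, decide_eq_true_eq]
  by_cases he : s i = s w
  · simp only [he, if_true, decide_true]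
    rw [← Nat.xor_assoc, Nat.xor_self, Nat.zero_xor, apply_markGate (fits_update hs i hw) hw]
    simp [ket, flagged_false]
  · simp only [he, if_false, decide_false, Function.update_eq_self]
    -- Without a replacement the entry is still larger than w, so the final gate leaves the clear
    -- flag alone.
    rw [apply_markGate hs hw, decide_eq_false hi.ne', ket, ← flagged_false s a]
    simp

/-- The blocks of the insertion recursion, with the angles `angle w` of the phase shifts and the
global phases `phase w` that are corrected. -/
noncomputable def insertionBlocks (hN : 2 ≤ N) (angle phase : Fin N → ℝ) : Blocks N where
  prep := writeCircuit ⟨N - 2, by omega⟩ (N - 1) ++ writeCircuit ⟨N - 1, by omega⟩ (N - 2)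
  oracle w := phaseCircuit w ⟨0, width_pos hN⟩ ((List.range N).filter fun j => (w : ℕ) < j)
    (angle w)
  zero w := phaseCircuit w ⟨0, width_pos hN⟩ [0] (angle w)
  angle := angle
  iterations _ := ⌈Real.sqrt (2 ^ width N)⌉₊
  fix w := [Gate.rz (-(2 * -phase w)) (Sum.inr ⟨0, width_pos hN⟩)]
  replace w i := compareReplaceCircuit w i ⟨0, width_pos hN⟩

theorem compareReplace_insertionBlocks (hN : 2 ≤ N) (angle phase : Fin N → ℝ) {w i : Fin N}
    (h : w < i) : (insertionBlocks hN angle phase).CompareReplace w i :=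
  ⟨actsOn_compareReplaceCircuit _ _ _, isMCX_of_mem_compareReplaceCircuit _ _ _,
    fun _ hs _ _ hi _ => run_compareReplaceCircuit h.ne' _ hs hi⟩

theorem filter_range_eq_map_Ioi (w : Fin N) :
    (Finset.range (2 ^ width N)).filter (fun j => (w : ℕ) < j ∧ j < N) =
      (Finset.Ioi w).map Fin.valEmbedding := by
  ext j
  simp only [Finset.mem_filter, Finset.mem_range, Finset.mem_map, Finset.mem_Ioi,
    Fin.valEmbedding_apply]
  constructor
  · rintro ⟨-, h1, h2⟩
    exact ⟨⟨j, h2⟩, h1, rfl⟩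
  · rintro ⟨k, hk, rfl⟩
    exact ⟨k.2.trans_le (le_two_pow_width N), hk, k.2⟩

/-- One iteration count serves all w: the marked fraction is at least 1/2^m, and π/(2(2n+1)) ≤
1/√(2^m) already for n = ⌈√(2^m)⌉, by π ≤ 4. The range condition sits inside the existential so that
angles can be chosen as functions of every w. -/
theorem exists_angle_phase (w : Fin N) : ∃ φ θ : ℝ, (w : ℕ) + 2 < N →
    groverCoeff (Complex.exp (φ * Complex.I)) (((N : ℝ) - w - 1) / 2 ^ width N)
      ⌈Real.sqrt (2 ^ width N)⌉₊ =
      (Complex.exp (θ * Complex.I) *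
        (1 / Real.sqrt (((N : ℝ) - w - 1) / 2 ^ width N) : ℝ), 0) := by
  by_cases hw : (w : ℕ) + 2 < N
  · have hM : (1 : ℝ) ≤ (N : ℝ) - w - 1 := by
      have : ((w : ℕ) : ℝ) + 2 ≤ N := by exact_mod_cast hw.le
      linarith
    set n := ⌈Real.sqrt (2 ^ width N)⌉₊ with hn
    have hD : 0 < Real.sqrt (2 ^ width N) := Real.sqrt_pos.2 (by positivity)
    have hle : Real.sqrt (2 ^ width N) ≤ n := Nat.le_ceil _
    have hsin : Real.sin (Real.pi / (2 * n + 1) / 2) ≤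
        Real.sqrt (((N : ℝ) - w - 1) / 2 ^ width N) := by
      calc Real.sin (Real.pi / (2 * n + 1) / 2) ≤ Real.pi / (2 * n + 1) / 2 :=
            Real.sin_le (by positivity)
        _ ≤ 1 / Real.sqrt (2 ^ width N) := by
            rw [div_div, div_le_div_iff₀ (by positivity) hD]
            nlinarith [Real.pi_le_four, Real.pi_pos]
        _ ≤ Real.sqrt ((N : ℝ) - w - 1) / Real.sqrt (2 ^ width N) := by
            gcongr
            rw [Real.le_sqrt' one_pos]
            linarith
        _ = _ := by rw [Real.sqrt_div (by linarith)]
    obtain ⟨φ, θ, h⟩ := exists_angle_groverCoeff _ (by positivity) n (Nat.ceil_pos.2 hD) hsin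
    exact ⟨φ, θ, fun _ => h⟩
  · exact ⟨0, 0, fun h => absurd h hw⟩

theorem exactAmplification_insertionBlocks (hN : 2 ≤ N) (angle phase : Fin N → ℝ) {w : Fin N}
    (hw : (w : ℕ) + 2 < N)
    (h : groverCoeff (Complex.exp (angle w * Complex.I)) (((N : ℝ) - w - 1) / 2 ^ width N)
      ⌈Real.sqrt (2 ^ width N)⌉₊ =
      (Complex.exp (phase w * Complex.I) *
        (1 / Real.sqrt (((N : ℝ) - w - 1) / 2 ^ width N) : ℝ), 0)) :
    (insertionBlocks hN angle phase).ExactAmplification w := by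
  set B := insertionBlocks hN angle phase with hB
  have ho : IsPhase (B.oracle w) w (fun j => (w : ℕ) < j ∧ j < N) (angle w) := by
    refine isPhase_phaseCircuit _ _ _ (List.nodup_range.filter _) ?_ _ ?_ _
    · intro j hj
      exact (List.mem_range.1 (List.mem_filter.1 hj).1).trans_le (le_two_pow_width N)
    · intro j
      simp [and_comm]
  have hz : IsPhase (B.zero w) w (fun j => j = 0) (angle w) :=
    isPhase_phaseCircuit _ _ _ (List.nodup_singleton 0) (by simp) _ (by simp) _
  have hf : IsPhase (B.fix w) w (fun _ => True) (-phase w) := isPhase_rz_ancilla _ _ _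
  refine ⟨?_, ho, hz, ⟨_, hf⟩, ?_⟩
  · have hh := actsOn_hadamards w
    refine (hh.append (Circuit.ActsOn.flatten_replicate ?_ _)).append ?_
    · exact (((actsOn_phaseCircuit _ _ _ _).append hh).append
        (actsOn_phaseCircuit _ _ _ _)).append hh
    · intro g hg
      change g ∈ [Gate.rz _ _] at hg
      rw [List.mem_singleton] at hg
      subst hg
      exact Set.singleton_subset_iff.2 (Or.inr ⟨_, rfl⟩)
  · intro s hs hs0
    have hM : (0 : ℝ) < (N : ℝ) - w - 1 := by
      have : ((w : ℕ) : ℝ) + 2 < N := by exact_mod_cast hw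
      linarith
    have hcard : (((Finset.Ioi w).map Fin.valEmbedding).card : ℝ) = (N : ℝ) - w - 1 := by
      rw [Finset.card_map, Fin.card_Ioi, Nat.sub_sub, Nat.cast_sub (by omega)]
      push_cast
      ring
    have hit := B.run_grover_iterate w _ (angle w) ho hz hs ⌈Real.sqrt (2 ^ width N)⌉₊
    rw [filter_range_eq_map_Ioi, hcard, h, Finset.sum_map] at hit
    have hfix : ∀ j ∈ Finset.Ioi w, (B.fix w).run (ket (Function.update s w (j : ℕ))) =
        Complex.exp (-(phase w * Complex.I)) • ket (Function.update s w (j : ℕ)) := by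
      intro j _
      rw [hf _ (fits_update hs w (j.2.trans_le (le_two_pow_width N))), if_pos trivial]
      push_cast
      rw [neg_mul]
    rw [Blocks.amplify, Circuit.run_append, Circuit.run_append, run_hadamards_ket_of_eq_zero w s hs0,
      Circuit.run_smul, Circuit.run_smul, Circuit.run_replicate]
    change _ • (B.fix w).run ((Circuit.run (B.grover w))^[⌈Real.sqrt (2 ^ width N)⌉₊] _) = _
    rw [hit, zero_smul, add_zero, Circuit.run_smul, Circuit.run_sum]
    simp only [Fin.valEmbedding_apply]
    rw [Finset.sum_congr rfl hfix, ← Finset.smul_sum, smul_smul, smul_smul]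
    congr 1
    have he : Complex.exp (phase w * Complex.I) * Complex.exp (-(phase w * Complex.I)) = 1 := by
      rw [← Complex.exp_add, add_neg_cancel, Complex.exp_zero]
    -- The normalisation of the uniform start times the gain 1/√p.
    have hr : (1 / Real.sqrt ((N : ℝ) - w - 1)) = 1 / Real.sqrt (2 ^ width N) *
        (1 / Real.sqrt (((N : ℝ) - w - 1) / 2 ^ width N)) := by
      rw [Real.sqrt_div hM.le]
      have h1 : Real.sqrt (2 ^ width N) ≠ 0 := (Real.sqrt_pos.2 (by positivity)).ne'
      have h2 : Real.sqrt ((N : ℝ) - w - 1) ≠ 0 := (Real.sqrt_pos.2 hM).ne'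
      field_simp
    rw [hr, Complex.ofReal_mul]
    linear_combination ((1 / Real.sqrt (2 ^ width N) : ℝ) : ℂ) *
      ((1 / Real.sqrt (((N : ℝ) - w - 1) / 2 ^ width N) : ℝ) : ℂ) * he

end HamCycle

/-! ### Combinatorics of inserting a vertex into a cycle. -/

namespace HamCycle

open Equiv Equiv.Perm

variable {N : ℕ}

theorem mem_cyclesFrom {k : ℕ} {σ : Perm (Fin N)} :
    σ ∈ cyclesFrom N k ↔ σ.IsCycle ∧ ∀ i : Fin N, σ i ≠ i ↔ k ≤ (i : ℕ) := by
  simp [cyclesFrom]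

/-- The new permutation sends w to j and then follows the σ-orbit of j, with a detour through w just
before it would return to j; so every moved point lies in the cycle of w. -/
theorem isCycle_swap_mul {α : Type*} [DecidableEq α] [Finite α] {σ : Perm α} (hσ : σ.IsCycle)
    {w j : α} (hw : σ w = w) (hj : σ j ≠ j) : (swap w j * σ).IsCycle := by
  have hwj : w ≠ j := by rintro rfl; exact hj hw
  have hfw : (swap w j * σ) w = j := by simp [hw]
  have hpow : ∀ n : ℕ, (swap w j * σ).SameCycle w ((σ ^ n) j) := by
    intro n
    induction n with
    | zero => exact ⟨1, by simpa using hfw⟩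
    | succ n ih =>
      by_cases hx : σ ((σ ^ n) j) = j
      · rw [pow_succ', Perm.mul_apply, hx]
        exact ⟨1, by simpa using hfw⟩
      · have hne : σ ((σ ^ n) j) ≠ w := by
          intro h
          have h' : (σ ^ (n + 1)) j = (σ ^ (n + 1)) w := by
            rw [Perm.pow_apply_eq_self_of_apply_eq_self hw, pow_succ', Perm.mul_apply, h]
          exact hwj ((σ ^ (n + 1)).injective h').symm
        have hf : (swap w j * σ) ((σ ^ n) j) = (σ ^ (n + 1)) j := by
          rw [Perm.mul_apply, swap_apply_of_ne_of_ne hne hx, pow_succ', Perm.mul_apply]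
        rw [← hf]
        exact (sameCycle_apply_right).2 ih
  refine ⟨w, by rw [hfw]; exact hwj.symm, fun y hy => ?_⟩
  by_cases hyw : y = w
  · rw [hyw]
  · have hσy : σ y ≠ y := by
      intro h
      apply hy
      by_cases hyj : y = j
      · exact absurd (hyj ▸ h) hj
      · rw [Perm.mul_apply, h, swap_apply_of_ne_of_ne hyw hyj]
    obtain ⟨n, hn⟩ := hσ.exists_pow_eq hj hσy
    rw [← hn]
    exact hpow n

theorem insertVertex_mem {w j : Fin N} (hj : w < j) {σ : Perm (Fin N)}
    (hσ : σ ∈ cyclesFrom N (w + 1)) : insertVertex w j σ ∈ cyclesFrom N w := by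
  rw [mem_cyclesFrom] at hσ ⊢
  obtain ⟨hc, hs⟩ := hσ
  have hw : σ w = w := by
    by_contra h
    have := (hs w).1 h
    omega
  refine ⟨isCycle_swap_mul hc hw ((hs j).2 hj), fun i => ?_⟩
  rcases lt_trichotomy i w with hi | hi | hi
  · have h : σ i = i := by
      by_contra h
      have := (hs i).1 h
      have := Fin.lt_def.1 hi
      omega
    have h1 : (insertVertex w j σ) i = i := by
      rw [insertVertex, Perm.mul_apply, h, swap_apply_of_ne_of_ne hi.ne (hi.trans hj).ne]
    simpa [h1] using hi
  · subst hi
    simp [insertVertex, hw, hj.ne']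
  · have h : σ i ≠ i := (hs i).2 hi
    refine iff_of_true ?_ (Fin.lt_def.1 hi).le
    rw [insertVertex, Perm.mul_apply]
    by_cases h1 : σ i = j
    · rw [h1, swap_apply_right]
      exact hi.ne
    · rw [swap_apply_of_ne_of_ne _ h1]
      · exact h
      · intro h2
        exact hi.ne' (σ.injective (h2.trans hw.symm))

theorem exists_insertVertex_eq {w : Fin N} (hw : (w : ℕ) + 2 < N) {τ : Perm (Fin N)}
    (hτ : τ ∈ cyclesFrom N w) :
    ∃ j, w < j ∧ ∃ σ ∈ cyclesFrom N (w + 1), insertVertex w j σ = τ := by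
  rw [mem_cyclesFrom] at hτ
  obtain ⟨hc, hs⟩ := hτ
  have hτw : τ w ≠ w := (hs w).2 le_rfl
  have hττ : τ (τ w) ≠ τ w := fun h => hτw (τ.injective h)
  have hle : (w : ℕ) ≤ (τ w : ℕ) := (hs _).1 hττ
  have hlt : w < τ w := lt_of_le_of_ne hle hτw.symm
  -- Otherwise τ would be a transposition, yet it moves the three points w, w+1, w+2. This is where
  -- `hw` is needed.
  have hne : τ (τ w) ≠ w := by
    intro h
    have heq := hc.eq_swap_of_apply_apply_eq_self hτw h
    have hfix : ∀ i : Fin N, i ≠ w → i ≠ τ w → ¬ (w : ℕ) ≤ i := by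
      intro i h1 h2 h3
      refine (hs i).2 h3 ?_
      rw [heq]
      exact swap_apply_of_ne_of_ne h1 h2
    have h1 := hfix ⟨w + 1, by omega⟩
    have h2 := hfix ⟨w + 2, by omega⟩
    simp only [ne_eq, Fin.ext_iff] at h1 h2
    by_cases h3 : (w : ℕ) + 1 = (τ w : ℕ)
    · exact h2 (by omega) (by omega) (by omega)
    · exact h1 (by omega) h3 (by omega)
  refine ⟨τ w, hlt, swap w (τ w) * τ, ?_, ?_⟩
  · rw [mem_cyclesFrom]
    refine ⟨hc.swap_mul hτw hne, fun i => ?_⟩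
    rw [Perm.mul_apply]
    by_cases hi : i = w
    · subst hi
      simp
    have hiw : (i : ℕ) ≠ w := fun h => hi (Fin.ext h)
    have h1 : τ i ≠ τ w := fun h => hi (τ.injective h)
    by_cases h2 : τ i = w
    · rw [h2, swap_apply_left]
      refine iff_of_true ?_ ?_
      · rintro rfl
        exact hne h2
      · have : τ i ≠ i := by rw [h2]; exact Ne.symm hi
        have := (hs i).1 this
        omega
    · rw [swap_apply_of_ne_of_ne h2 h1, hs i]
      omega
  · rw [insertVertex, ← mul_assoc, swap_mul_self, one_mul]

/-- Evaluating at w, which σ fixes, recovers j; then the swap cancels. -/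
theorem insertVertex_injective {w j j' : Fin N} {σ σ' : Perm (Fin N)}
    (hσ : σ ∈ cyclesFrom N (w + 1)) (hσ' : σ' ∈ cyclesFrom N (w + 1))
    (h : insertVertex w j σ = insertVertex w j' σ') : j = j' ∧ σ = σ' := by
  have hfix : ∀ {τ : Perm (Fin N)}, τ ∈ cyclesFrom N (w + 1) → τ w = w := by
    intro τ hτ
    by_contra h
    have := ((mem_cyclesFrom.1 hτ).2 w).1 h
    omega
  have hj : j = j' := by
    have := DFunLike.congr_fun h w
    simpa [insertVertex, hfix hσ, hfix hσ'] using this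
  subst hj
  exact ⟨rfl, mul_left_cancel h⟩

/-- Stated for an arbitrary summand so that it yields both the superposition of kets and, with
constant 1, the number of cycles. -/
theorem sum_cyclesFrom {M : Type*} [AddCommMonoid M] {w : Fin N} (hw : (w : ℕ) + 2 < N)
    (f : Perm (Fin N) → M) :
    ∑ σ ∈ cyclesFrom N (w + 1), ∑ j ∈ Finset.Ioi w, f (insertVertex w j σ) =
      ∑ τ ∈ cyclesFrom N w, f τ := by
  rw [← Finset.sum_product']
  refine Finset.sum_bij (fun p _ => insertVertex w p.2 p.1) ?_ ?_ ?_ ?_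
  · rintro ⟨σ, j⟩ h
    rw [Finset.mem_product] at h
    exact insertVertex_mem (Finset.mem_Ioi.1 h.2) h.1
  · rintro ⟨σ, j⟩ h ⟨σ', j'⟩ h' heq
    rw [Finset.mem_product] at h h'
    obtain ⟨rfl, rfl⟩ := insertVertex_injective h.1 h'.1 heq
    rfl
  · intro τ hτ
    obtain ⟨j, hj, σ, hσ, h⟩ := exists_insertVertex_eq hw hτ
    exact ⟨(σ, j), Finset.mem_product.2 ⟨hσ, Finset.mem_Ioi.2 hj⟩, h⟩
  · rintro ⟨σ, j⟩ h
    rfl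

theorem cyclesFrom_sub_two (hN : 2 ≤ N) :
    cyclesFrom N (N - 2) = {swap ⟨N - 2, by omega⟩ ⟨N - 1, by omega⟩} := by
  have hab : (⟨N - 2, by omega⟩ : Fin N) ≠ ⟨N - 1, by omega⟩ := by
    simp only [ne_eq, Fin.mk.injEq]; omega
  have hcase : ∀ i : Fin N, N - 2 ≤ (i : ℕ) ↔
      i = (⟨N - 2, by omega⟩ : Fin N) ∨ i = ⟨N - 1, by omega⟩ := by
    intro i
    simp only [Fin.ext_iff]
    omega
  ext σ
  rw [Finset.mem_singleton, mem_cyclesFrom]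
  constructor
  · rintro ⟨hc, hs⟩
    have ha : σ ⟨N - 2, by omega⟩ ≠ ⟨N - 2, by omega⟩ := (hs _).2 le_rfl
    have hσa : σ ⟨N - 2, by omega⟩ = ⟨N - 1, by omega⟩ :=
      ((hcase _).1 ((hs _).1 fun h => ha (σ.injective h))).resolve_left ha
    have hb : σ ⟨N - 1, by omega⟩ ≠ ⟨N - 1, by omega⟩ := (hs _).2 (by simp only; omega)
    have hσb : σ ⟨N - 1, by omega⟩ = ⟨N - 2, by omega⟩ :=
      ((hcase _).1 ((hs _).1 fun h => hb (σ.injective h))).resolve_right hb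
    have := hc.eq_swap_of_apply_apply_eq_self ha (by rw [hσa, hσb])
    rwa [hσa] at this
  · rintro rfl
    refine ⟨isCycle_swap hab, fun i => ?_⟩
    rw [hcase i, swap_apply_ne_self_iff]
    exact and_iff_right hab

theorem card_cyclesFrom (hN : 2 ≤ N) (k : ℕ) (hk : k + 2 ≤ N) :
    (cyclesFrom N k).card = (N - k - 1).factorial := by
  have hk2 : k ≤ N - 2 := Nat.le_sub_of_add_le hk
  induction hk2 using Nat.decreasingInduction with
  | self =>
    rw [cyclesFrom_sub_two hN, Finset.card_singleton, show N - (N - 2) - 1 = 1 by omega,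
      Nat.factorial_one]
  | of_succ k hk' ih =>
    have h := sum_cyclesFrom (N := N) (w := ⟨k, by omega⟩) (by simp only; omega) fun _ => 1
    simp only [Finset.sum_const, smul_eq_mul, mul_one, Fin.card_Ioi] at h
    rw [← h, ih (by omega), show N - k - 1 = (N - (k + 1) - 1) + 1 by omega, Nat.factorial_succ]
    rw [show N - 1 - k = N - (k + 1) - 1 + 1 by omega, mul_comm]

end HamCycle

/-! ### The insertion recursion on states. -/

namespace HamCycle

variable {N : ℕ}

namespace Blocks

/-- Register w is never altered and no register is visited twice, so each module sees the original
entries and the replacements act simultaneously. -/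
theorem run_flatMap_replace (B : Blocks N) (w : Fin N) (L : List (Fin N)) (hL : L.Nodup)
    (hw : ∀ i ∈ L, w < i) (hB : ∀ i, w < i → B.CompareReplace w i) {t : Fin N → ℕ} (ht : Fits t)
    (htw : (w : ℕ) < t w) (htw' : t w < N) (htL : ∀ i ∈ L, (w : ℕ) < t i ∧ t i < N) :
    Circuit.run (L.flatMap (B.replace w)) (ket t) =
      ket fun i => if i ∈ L ∧ t i = t w then (w : ℕ) else t i := by
  induction L generalizing t with
  | nil => simp
  | cons i L ih =>
    rw [List.nodup_cons] at hL
    have hi := htL i (by simp)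
    have hwi := hw i (by simp)
    set v := if t i = t w then (w : ℕ) else t i with hv
    have hvlt : v < 2 ^ width N := by
      rw [hv]
      split_ifs
      · exact w.2.trans_le (le_two_pow_width N)
      · exact ht i
    rw [List.flatMap_cons, Circuit.run_append, (hB i hwi).2.2 t ht htw htw' hi.1 hi.2, ← hv,
      ih hL.2 (fun k hk => hw k (by simp [hk])) (fits_update ht i hvlt)]
    · congr 1
      funext k
      rw [Function.update_of_ne hwi.ne]
      by_cases hk : k = i
      · subst hk
        simp [hL.1, hv]
      · simp [hk]
    · rwa [Function.update_of_ne hwi.ne]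
    · rwa [Function.update_of_ne hwi.ne]
    · intro k hk
      rw [Function.update_of_ne (by rintro rfl; exact hL.1 hk)]
      exact htL k (by simp [hk])

/-- In the branch j the only overwritten register is that of the σ-predecessor of j, which is
exactly the effect of composing with the swap of w and j. -/
theorem coherentInsertion (B : Blocks N) {w : Fin N} (hA : B.ExactAmplification w)
    (hB : ∀ i, w < i → B.CompareReplace w i) : B.CoherentInsertion w := by
  intro σ hσ
  rw [mem_cyclesFrom] at hσ
  obtain ⟨-, hs⟩ := hσ
  have hw : σ w = w := by
    by_contra h
    have := (hs w).1 h
    omega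
  have hfits : Fits (successors (w + 1) σ) := by
    intro i
    unfold successors
    split_ifs
    · exact (σ i).2.trans_le (le_two_pow_width N)
    · positivity
  rw [step, Circuit.run_append, hA.2.2.2.2 _ hfits (by simp [successors]), Circuit.run_smul,
    Circuit.run_sum]
  congr 1
  refine Finset.sum_congr rfl fun j hj => ?_
  rw [Finset.mem_Ioi] at hj
  rw [B.run_flatMap_replace w _ ((List.nodup_finRange N).filter _) (by simp) hB
    (fits_update hfits w (j.2.trans_le (le_two_pow_width N)))
    (by simpa using hj) (by simp)]
  · congr 1
    funext i
    rw [Function.update_self]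
    rcases lt_trichotomy i w with hi | hi | hi
    · have h1 := Fin.lt_def.1 hi
      simp [hi.not_gt, hi.ne, successors, h1.not_ge, show ¬ (w : ℕ) + 1 ≤ i by omega]
    · subst hi
      simp [successors, insertVertex, hw]
    · have h1 : (w : ℕ) + 1 ≤ i := Fin.lt_def.1 hi
      have h2 : (w : ℕ) ≤ i := by omega
      have h3 : σ i ≠ w := fun h => hi.ne' (σ.injective (h.trans hw.symm))
      simp only [List.mem_filter, List.mem_finRange, decide_eq_true_eq, hi, true_and,
        Function.update_of_ne hi.ne', successors, if_pos h1, if_pos h2, insertVertex,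
        Equiv.Perm.mul_apply]
      by_cases h4 : σ i = j
      · rw [h4, Equiv.swap_apply_right, if_pos rfl]
      · rw [Equiv.swap_apply_of_ne_of_ne h3 h4, if_neg fun h => h4 (Fin.ext h)]
  · intro i hi
    have hi' : w < i := by simpa using hi
    have h1 : (w : ℕ) + 1 ≤ i := Fin.lt_def.1 hi'
    rw [Function.update_of_ne hi'.ne', successors, if_pos h1]
    refine ⟨?_, (σ i).2⟩
    have h2 : σ (σ i) ≠ σ i := fun h => (hs i).2 h1 (σ.injective h)
    exact (hs _).1 h2

theorem run_step_uniformFrom (B : Blocks N) {w : Fin N} (hw : (w : ℕ) + 2 < N)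
    (hB : B.CoherentInsertion w) :
    (B.step w).run (uniformFrom N (w + 1)) = uniformFrom N w := by
  rw [uniformFrom, Circuit.run_smul, Circuit.run_sum, Finset.sum_congr rfl fun σ hσ => hB σ hσ,
    ← Finset.smul_sum, sum_cyclesFrom hw fun τ => ket (successors w τ), smul_smul, uniformFrom,
    ← Complex.ofReal_mul]
  congr 2
  rw [div_mul_div_comm, one_mul, ← Real.sqrt_mul (by positivity),
    show N - w - 1 = (N - (w + 1) - 1) + 1 by omega, Nat.factorial_succ, Nat.cast_mul, mul_comm]
  congr 4
  rw [show N - ((w : ℕ) + 1) - 1 + 1 = N - (w + 1) by omega, Nat.cast_sub (by omega)]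
  push_cast
  ring

theorem filter_finRange_eq_cons {k : ℕ} (hk : k + 2 < N) :
    ((List.finRange N).filter fun w : Fin N => k ≤ (w : ℕ) ∧ (w : ℕ) + 2 < N) =
      ⟨k, by omega⟩ ::
        ((List.finRange N).filter fun w : Fin N => k + 1 ≤ (w : ℕ) ∧ (w : ℕ) + 2 < N) := by
  have hs : (List.finRange N).Pairwise (· < ·) := List.pairwise_lt_finRange N
  -- Both lists are strictly increasing with the same members, hence equal.
  refine List.Perm.eq_of_pairwise (le := (· < ·)) (fun a b _ _ h h' => absurd h h'.asymm) (hs.filter _) ?_ ?_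
  · rw [List.pairwise_cons]
    refine ⟨fun a ha => ?_, hs.filter _⟩
    simp only [List.mem_filter, decide_eq_true_eq] at ha
    exact Fin.lt_def.2 ha.2.1
  · rw [List.perm_ext_iff_of_nodup ((List.nodup_finRange N).filter _)]
    · intro a
      simp only [List.mem_filter, List.mem_finRange, decide_eq_true_eq, true_and, List.mem_cons,
        Fin.ext_iff]
      omega
    · rw [List.nodup_cons]
      exact ⟨by simp, (List.nodup_finRange N).filter _⟩

theorem stage_eq_append (B : Blocks N) {k : ℕ} (hk : k + 2 < N) :
    B.stage k = B.stage (k + 1) ++ B.step ⟨k, by omega⟩ := by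
  rw [stage, filter_finRange_eq_cons hk, List.reverse_cons, List.flatMap_append, stage,
    List.append_assoc]
  simp

theorem run_stage (B : Blocks N)
    (hprep : B.prep.run (ket fun _ => 0) = uniformFrom N (N - 2))
    (hB : ∀ w : Fin N, (w : ℕ) + 2 < N → B.CoherentInsertion w) (k : ℕ) (hk : k + 2 ≤ N) :
    (B.stage k).run (ket fun _ => 0) = uniformFrom N k := by
  have hk2 : k ≤ N - 2 := Nat.le_sub_of_add_le hk
  induction hk2 using Nat.decreasingInduction with
  | self =>
    have : ((List.finRange N).filter
        fun w : Fin N => N - 2 ≤ (w : ℕ) ∧ (w : ℕ) + 2 < N) = [] := by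
      rw [List.filter_eq_nil_iff]
      intro a _
      simp only [decide_eq_true_eq]
      omega
    rw [stage, this]
    simpa using hprep
  | of_succ k hk' ih =>
    rw [stage_eq_append B (by omega), Circuit.run_append, ih (by omega)]
    exact run_step_uniformFrom B (w := ⟨k, by omega⟩) (by simp only; omega) (hB _ (by simp only; omega))

end Blocks

theorem run_prep_insertionBlocks (hN : 2 ≤ N) (angle phase : Fin N → ℝ) :
    (insertionBlocks hN angle phase).prep.run (ket fun _ => 0) = uniformFrom N (N - 2) := by
  have hab : (⟨N - 1, by omega⟩ : Fin N) ≠ ⟨N - 2, by omega⟩ := by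
    simp only [ne_eq, Fin.mk.injEq]; omega
  have h1 : N - (N - 2) - 1 = 1 := by omega
  rw [uniformFrom, cyclesFrom_sub_two hN, Finset.sum_singleton, h1]
  change Circuit.run (_ ++ _) _ = _
  rw [Circuit.run_append, run_writeCircuit _ _ _ rfl, run_writeCircuit _ _ _ (by simp [hab])]
  simp only [Nat.factorial_one, Nat.cast_one, Real.sqrt_one, div_one, Complex.ofReal_one,
    one_smul]
  congr 1
  funext i
  by_cases hi : i = ⟨N - 1, by omega⟩
  · subst hi
    simp only [Function.update_self, successors, Equiv.swap_apply_right]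
    rw [if_pos (by omega)]
  · rw [Function.update_of_ne hi]
    by_cases hi' : i = ⟨N - 2, by omega⟩
    · subst hi'
      simp [successors]
    · rw [Function.update_of_ne hi', successors, if_neg]
      simp only [Fin.ext_iff] at hi hi'
      omega

/-! ### Gate count. -/

theorem length_step_insertionBlocks_le (hN : 2 ≤ N) (angle phase : Fin N → ℝ) (w : Fin N) :
    ((insertionBlocks hN angle phase).step w).length ≤
      width N + ⌈Real.sqrt (2 ^ width N)⌉₊ * (2 * N + 2 * width N + 6) + 1 +
        N * (3 * width N + 2) := by
  set a : Fin (width N) := ⟨0, width_pos hN⟩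
  have hg : ((insertionBlocks hN angle phase).grover w).length ≤ 2 * N + 2 * width N + 6 := by
    have hl : ((List.range N).filter fun j => (w : ℕ) < j).length ≤ N := by
      simpa using List.length_filter_le (fun j => decide ((w : ℕ) < j)) (List.range N)
    have h1 := length_phaseCircuit w a ((List.range N).filter fun j => (w : ℕ) < j) (angle w)
    have h2 := length_phaseCircuit w a [0] (angle w)
    have h3 : (hadamards w).length = width N := by simp [hadamards]
    simp only [Blocks.grover, List.length_append]
    change (phaseCircuit w a ((List.range N).filter fun j => (w : ℕ) < j) (angle w)).length + _ +
      (phaseCircuit w a [0] (angle w)).length + _ ≤ _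
    rw [h1, h2, h3, List.length_singleton]
    omega
  have hr : (((List.finRange N).filter fun i => w < i).flatMap
      ((insertionBlocks hN angle phase).replace w)).length ≤ N * (3 * width N + 2) := by
    rw [List.length_flatMap]
    refine (List.sum_le_card_nsmul _ (3 * width N + 2) ?_).trans ?_
    · intro x hx
      obtain ⟨i, -, rfl⟩ := List.mem_map.1 hx
      exact length_compareReplaceCircuit_le _ _ _
    · rw [List.length_map, smul_eq_mul]
      refine Nat.mul_le_mul_right _ ?_
      simpa using List.length_filter_le (fun i => decide (w < i)) (List.finRange N)
  have ha : ((insertionBlocks hN angle phase).amplify w).length =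
      width N + ⌈Real.sqrt (2 ^ width N)⌉₊ *
        ((insertionBlocks hN angle phase).grover w).length + 1 := by
    have h1 : ((insertionBlocks hN angle phase).fix w).length = 1 := rfl
    have h2 : (insertionBlocks hN angle phase).iterations w = ⌈Real.sqrt (2 ^ width N)⌉₊ := rfl
    have h3 : (hadamards w).length = width N := by simp [hadamards]
    rw [Blocks.amplify, List.length_append, List.length_append, h1, h2, h3, List.length_flatten,
      List.map_replicate, List.sum_replicate, smul_eq_mul]
  rw [Blocks.step, List.length_append, ha]
  gcongr

theorem length_circuit_insertionBlocks_le (hN : 2 ≤ N) (angle phase : Fin N → ℝ) :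
    (insertionBlocks hN angle phase).circuit.length ≤
      2 * width N + N * (width N + ⌈Real.sqrt (2 ^ width N)⌉₊ * (2 * N + 2 * width N + 6) + 1 +
        N * (3 * width N + 2)) := by
  have hp : (insertionBlocks hN angle phase).prep.length ≤ 2 * width N := by
    have h : ∀ (i : Fin N) (v : ℕ), (writeCircuit i v).length ≤ width N := by
      intro i v
      rw [writeCircuit, List.length_map]
      simpa using List.length_filter_le (fun b : Fin (width N) => v.testBit b) (List.finRange _)
    simp only [insertionBlocks, List.length_append]
    have h1 := h ⟨N - 2, by omega⟩ (N - 1)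
    have h2 := h ⟨N - 1, by omega⟩ (N - 2)
    omega
  rw [Blocks.circuit, Blocks.stage, List.length_append]
  refine add_le_add hp ?_
  rw [List.length_flatMap]
  refine (List.sum_le_card_nsmul _ (width N + ⌈Real.sqrt (2 ^ width N)⌉₊ *
    (2 * N + 2 * width N + 6) + 1 + N * (3 * width N + 2)) ?_).trans ?_
  · intro x hx
    obtain ⟨i, -, rfl⟩ := List.mem_map.1 hx
    exact length_step_insertionBlocks_le _ _ _ _
  · rw [List.length_map, smul_eq_mul, List.length_reverse]
    refine Nat.mul_le_mul_right _ ?_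
    simpa using List.length_filter_le
      (fun w : Fin N => decide (0 ≤ (w : ℕ) ∧ (w : ℕ) + 2 < N)) (List.finRange N)

theorem sq_le_two_mul_two_pow (m : ℕ) : m ^ 2 ≤ 2 * 2 ^ m := by
  induction m with
  | zero => norm_num
  | succ m ih =>
    by_cases h : m < 3
    · interval_cases m <;> norm_num
    · rw [pow_succ 2 m]
      nlinarith

theorem gate_count_bound (hN : 2 ≤ N) :
    (2 * width N + N * (width N + ⌈Real.sqrt (2 ^ width N)⌉₊ * (2 * N + 2 * width N + 6) + 1 +
        N * (3 * width N + 2)) : ℝ) ≤ 51 * (N : ℝ) ^ (5 / 2 : ℝ) := by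
  have hN' : (2 : ℝ) ≤ N := by exact_mod_cast hN
  have hpow : ((2 : ℝ) ^ width N) ≤ 2 * N := by exact_mod_cast two_pow_width_le hN
  have hsq : (width N : ℝ) ^ 2 ≤ 2 * 2 ^ width N := by
    exact_mod_cast sq_le_two_mul_two_pow (width N)
  set r := Real.sqrt N with hr
  have hrr : r ^ 2 = N := Real.sq_sqrt (by linarith)
  have hr0 : 0 ≤ r := Real.sqrt_nonneg _
  have hr1 : 1 ≤ r := by
    rw [hr, Real.one_le_sqrt]; linarith
  -- From m² ≤ 2·2^m ≤ 4N. This crude bound on the logarithm suffices, since N² log N is of lower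
  -- order than N^{5/2}.
  have hm : (width N : ℝ) ≤ 2 * r := by
    refine le_of_sq_le_sq ?_ (by positivity)
    nlinarith
  have hceil : (⌈Real.sqrt (2 ^ width N)⌉₊ : ℝ) ≤ 3 * r := by
    have h1 := (Nat.ceil_lt_add_one (Real.sqrt_nonneg (2 ^ width N))).le
    have h2 : Real.sqrt (2 ^ width N) ≤ 2 * r := by
      rw [Real.sqrt_le_left (by positivity)]
      nlinarith
    linarith
  have hrpow : (N : ℝ) ^ (5 / 2 : ℝ) = r ^ 5 := by
    rw [hr, Real.sqrt_eq_rpow, ← Real.rpow_natCast, ← Real.rpow_mul (by linarith)]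
    norm_num
  have hm0 : (0 : ℝ) ≤ width N := Nat.cast_nonneg _
  rw [hrpow, ← hrr]
  have hbound : (2 * width N + r ^ 2 * (width N + ⌈Real.sqrt (2 ^ width N)⌉₊ *
      (2 * r ^ 2 + 2 * width N + 6) + 1 + r ^ 2 * (3 * width N + 2)) : ℝ) ≤
      2 * (2 * r) + r ^ 2 * (2 * r + 3 * r * (2 * r ^ 2 + 2 * (2 * r) + 6) + 1 +
        r ^ 2 * (3 * (2 * r) + 2)) := by
    gcongr
  refine hbound.trans ?_
  -- Every monomial is at most r⁵, and the coefficients of the expanded bound sum to 51.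
  have e1 : r ≤ r ^ 5 := le_self_pow₀ hr1 (by norm_num)
  have e2 : r ^ 2 ≤ r ^ 5 := pow_le_pow_right₀ hr1 (by norm_num)
  have e3 : r ^ 3 ≤ r ^ 5 := pow_le_pow_right₀ hr1 (by norm_num)
  have e4 : r ^ 4 ≤ r ^ 5 := pow_le_pow_right₀ hr1 (by norm_num)
  ring_nf
  linarith

end HamCycle

theorem theorem2 :
    ∃ C : ℝ, 0 < C ∧ ∀ N : ℕ, 2 ≤ N →
      (HamCycle.cyclesFrom N 0).card = (N - 1).factorial ∧
      ∃ B : HamCycle.Blocks N,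
        (∀ w : Fin N, (w : ℕ) + 2 < N →
          B.ExactAmplification w ∧
          (∀ i : Fin N, w < i → B.CompareReplace w i) ∧
          B.CoherentInsertion w) ∧
        (∀ k : ℕ, k + 2 ≤ N →
          (B.stage k).run (HamCycle.ket fun _ => 0) = HamCycle.uniformFrom N k) ∧
        B.circuit.run (HamCycle.ket fun _ => 0) =
          ((1 / Real.sqrt (((N - 1).factorial : ℕ) : ℝ) : ℝ) : ℂ) •
            ∑ σ ∈ HamCycle.cyclesFrom N 0, HamCycle.ket (fun i => (σ i : ℕ)) ∧
        (B.circuit.length : ℝ) ≤ C * (N : ℝ) ^ (5 / 2 : ℝ) := by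
  refine ⟨51, by norm_num, fun N hN => ⟨?_, ?_⟩⟩
  · exact HamCycle.card_cyclesFrom hN 0 (by omega)
  choose angle phase h using HamCycle.exists_angle_phase (N := N)
  set B := HamCycle.insertionBlocks hN angle phase with hB
  have hA : ∀ w : Fin N, (w : ℕ) + 2 < N → B.ExactAmplification w := fun w hw =>
    HamCycle.exactAmplification_insertionBlocks hN angle phase hw (h w hw)
  have hR : ∀ w i : Fin N, w < i → B.CompareReplace w i := fun w i hi =>
    HamCycle.compareReplace_insertionBlocks hN angle phase hi
  have hI : ∀ w : Fin N, (w : ℕ) + 2 < N → B.CoherentInsertion w := fun w hw =>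
    B.coherentInsertion (hA w hw) (hR w)
  have hS := B.run_stage (HamCycle.run_prep_insertionBlocks hN angle phase) hI
  -- For k = 0 the condition 0 ≤ i always holds, so `uniformFrom N 0` unfolds to the required final
  -- state and `hS 0` applies as it stands.
  refine ⟨B, fun w hw => ⟨hA w hw, hR w, hI w hw⟩, hS, hS 0 (by omega), ?_⟩
  have hlen : (B.circuit.length : ℝ) ≤ _ :=
    Nat.cast_le.2 (HamCycle.length_circuit_insertionBlocks_le hN angle phase)
  refine hlen.trans ?_
  have := HamCycle.gate_count_bound hN
  push_cast
  exact this
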